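/- Let $K$ be an algebraically closed field of characteristic $0$, and let $(\mathfrak g,s)$ be a solvable Lie algebra over $K$ with a filtration $s$, i.e. a chain of ideals $$\mathfrak g=\mathfrak g_0\supseteq\mathfrak g_1\supseteq\dots\supseteq\mathfrak g_k=\{0\}$$ (repetitions allowed) such that $\mathfrak g_{i}$ has codimension at most $1$ in $\mathfrak g_{i-1}$ for $1\le i\le k$. A $U(\mathfrak g,s)$-module $(V,s)$ is a (possibly infinite-dimensional) representation $V$ of $\mathfrak g$ over $K$ with a chain of subspaces $V=V_0\supseteq V_1\supseteq\dots\supseteq V_k$ such that each $V_i$ is invariant under $\mathfrak g_i$. It is irreducible if, for every $0\le i\le k$, $V_i$ is an irreducible representation of $\mathfrak g_i$. Two such modules $(V,s)$ and $(W,s)$ are isomorphic if there is an isomorphism $C:V\to W$ of representations of $\mathfrak g$ with $C(V_i)=W_i$ for all $i$. Let $\mathrm{Irr}(\mathfrak g,s)$ be the set of isomorphism classes of irreducible $U(\mathfrak g,s)$-modules. For $f\in\mathfrak g^*$ let $f_i=f|_{\mathfrak g_i}$, let $\mathfrak g_i^{f_i}=\{x\in\mathfrak g_i : f([x,\mathfrak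 g_i])=0\}$, and let $\mathfrak{pv}(f)=\sum_{i=0}^k\mathfrak g_i^{f_i}$ be the Vergne polarization; it is a subalgebra of $\mathfrak g$ with $f([\mathfrak{pv}(f),\mathfrak{pv}(f)])=0$, so that $f|_{\mathfrak{pv}(f)}$ is a character. Let $M(f)=U(\mathfrak g)\otimes_{U(\mathfrak{pv}(f))}K$ be the $U(\mathfrak g)$-module induced by this character, and let $M_s(f)$ be $M(f)$ with the filtration $$M(f)=M_0(f_0)\supseteq M_1(f_1)\supseteq\dots\supseteq M_k(f_k),$$ where $M_i(f_i)$ is the $U(\mathfrak g_i)$-module induced by the restriction of $f_i$ to its Vergne polarization in $\mathfrak g_i$ (with respect to the filtration induced by $s$ on $\mathfrak g_i$), regarded as a subspace of $M(f)$ through the natural map $u\otimes 1\mapsto u\otimes 1$. Theorem. For every $f\in\mathfrak g^*$ the $U(\mathfrak g,s)$-module $M_s(f)$ is irreducible, and every irreducible $U(\mathfrak g,s)$-module is isomorphic to $M_s(f)$ for some $f\in\mathfrak g^*$. In other words, $f\mapsto M_s(f)$ is a well-defined surjective map from $\mathfrak g^*$ to $\mathrm{Irr}(\mathfrak g,s)$.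 -/

import Mathlib

open scoped TensorProduct

noncomputable section

section Induction

attribute [local instance 100] LieRing.ofAssociativeRing

variable {K : Type*} [Field K]
variable {L : Type*} [LieRing L] [LieAlgebra K L]
variable {L' : Type*} [LieRing L'] [LieAlgebra K L']

/-- The homomorphism `U(φ) : U(L') → U(L)` of universal enveloping algebras defined by a
homomorphism `φ : L' → L` of Lie algebras. -/
def envMap (φ : L' →ₗ⁅K⁆ L) :
    UniversalEnvelopingAlgebra K L' →ₐ[K] UniversalEnvelopingAlgebra K L :=
  UniversalEnvelopingAlgebra.lift K ((UniversalEnvelopingAlgebra.ι K).comp φ)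

theorem envMap_ι (φ : L' →ₗ⁅K⁆ L) (x : L') :
    envMap φ (UniversalEnvelopingAlgebra.ι K x) = UniversalEnvelopingAlgebra.ι K (φ x) :=
  UniversalEnvelopingAlgebra.lift_ι_apply K _ x

theorem envMap_id (u : UniversalEnvelopingAlgebra K L) :
    envMap (LieHom.id : L →ₗ⁅K⁆ L) u = u := by
  have h : envMap (LieHom.id : L →ₗ⁅K⁆ L) = AlgHom.id K _ := by
    apply UniversalEnvelopingAlgebra.hom_ext
    ext x : 1
    exact envMap_ι _ x
  rw [h, AlgHom.id_apply]

theorem envMap_envMap {L'' : Type*} [LieRing L''] [LieAlgebra K L''] (φ : L' →ₗ⁅K⁆ L)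
    (ψ : L'' →ₗ⁅K⁆ L') (u : UniversalEnvelopingAlgebra K L'') :
    envMap φ (envMap ψ u) = envMap (φ.comp ψ) u := by
  have h : (envMap φ).comp (envMap ψ) = envMap (φ.comp ψ) := by
    apply UniversalEnvelopingAlgebra.hom_ext
    ext x : 1
    simp only [LieHom.comp_apply, AlgHom.toLieHom_apply, AlgHom.comp_apply, envMap_ι]
  exact DFunLike.congr_fun h u

variable {W : Type*} [AddCommGroup W] [Module K W]

/-- The relations `u a ⊗ w = u ⊗ a w` (`u ∈ U(L)`, `a ∈ U(p)`, `w ∈ W`) which cut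
`U(L) ⊗_{U(p)} W` out of `U(L) ⊗_K W`, where `p` is a subalgebra of `L` and `ρ` is a
representation of `p` in `W`. -/
def indRel (p : LieSubalgebra K L) (ρ : p →ₗ⁅K⁆ Module.End K W) :
    Submodule (UniversalEnvelopingAlgebra K L) (UniversalEnvelopingAlgebra K L ⊗[K] W) :=
  Submodule.span _ {z | ∃ (u : UniversalEnvelopingAlgebra K L)
    (a : UniversalEnvelopingAlgebra K p) (w : W),
    z = (u * envMap p.incl a) ⊗ₜ[K] w - u ⊗ₜ[K] (UniversalEnvelopingAlgebra.lift K ρ a w)}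

/-- The induced module `ind(W, L) = U(L) ⊗_{U(p)} W`. -/
def Ind (p : LieSubalgebra K L) (ρ : p →ₗ⁅K⁆ Module.End K W) : Type _ :=
  (UniversalEnvelopingAlgebra K L ⊗[K] W) ⧸ indRel p ρ

namespace Ind

variable (p : LieSubalgebra K L) (ρ : p →ₗ⁅K⁆ Module.End K W)

instance : AddCommGroup (Ind p ρ) :=
  inferInstanceAs (AddCommGroup ((UniversalEnvelopingAlgebra K L ⊗[K] W) ⧸ indRel p ρ))

instance : Module (UniversalEnvelopingAlgebra K L) (Ind p ρ) :=
  inferInstanceAs (Module _ ((UniversalEnvelopingAlgebra K L ⊗[K] W) ⧸ indRel p ρ))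

instance : Module K (Ind p ρ) :=
  inferInstanceAs (Module K ((UniversalEnvelopingAlgebra K L ⊗[K] W) ⧸ indRel p ρ))

instance : IsScalarTower K (UniversalEnvelopingAlgebra K L) (Ind p ρ) :=
  inferInstanceAs (IsScalarTower K _ ((UniversalEnvelopingAlgebra K L ⊗[K] W) ⧸ indRel p ρ))

/-- The representation of `L` in `ind(W, L)`: `x` acts as its image in `U(L)`. -/
instance : LieRingModule L (Ind p ρ) where
  bracket x m := UniversalEnvelopingAlgebra.ι K x • m
  add_lie x y m := by simp only [map_add, add_smul]
  lie_add x m n := smul_add _ _ _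
  leibniz_lie x y m := by
    simp only [LieHom.map_lie, LieRing.of_associative_ring_bracket, sub_smul, mul_smul,
      sub_add_cancel]

theorem lie_def (x : L) (m : Ind p ρ) : ⁅x, m⁆ = UniversalEnvelopingAlgebra.ι K x • m := rfl

instance : LieModule K L (Ind p ρ) where
  smul_lie c x m := by simp only [lie_def, map_smul, smul_assoc]
  lie_smul c x m := by simp only [lie_def, smul_algebra_smul_comm]

/-- The quotient map `U(L) ⊗_K W → U(L) ⊗_{U(p)} W`. -/
def mk : UniversalEnvelopingAlgebra K L ⊗[K] W →ₗ[UniversalEnvelopingAlgebra K L] Ind p ρ :=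
  (indRel p ρ).mkQ

variable {p ρ}

variable {p' : LieSubalgebra K L'} {ρ' : p' →ₗ⁅K⁆ Module.End K W}

/-- The `K`-linear map `U(L') ⊗_K W → ind(W, L)`, `u ⊗ w ↦ U(φ)(u) ⊗ w`. -/
def preMap (φ : L' →ₗ⁅K⁆ L) (p : LieSubalgebra K L) (ρ : p →ₗ⁅K⁆ Module.End K W) :
    UniversalEnvelopingAlgebra K L' ⊗[K] W →ₗ[K] Ind p ρ :=
  ((mk p ρ).restrictScalars K).comp (TensorProduct.map (envMap φ).toLinearMap LinearMap.id)

theorem preMap_smul (φ : L' →ₗ⁅K⁆ L) (u : UniversalEnvelopingAlgebra K L')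
    (z : UniversalEnvelopingAlgebra K L' ⊗[K] W) :
    preMap φ p ρ (u • z) = envMap φ u • preMap φ p ρ z := by
  induction z with
  | zero => simp
  | add a b ha hb => simp only [smul_add, map_add, ha, hb]
  | tmul v w =>
    simp only [preMap, LinearMap.comp_apply, TensorProduct.smul_tmul', TensorProduct.map_tmul,
      smul_eq_mul, AlgHom.toLinearMap_apply, map_mul, LinearMap.restrictScalars_apply,
      ← map_smul]

theorem preMap_eq_zero (φ : L' →ₗ⁅K⁆ L)
    (h : ∀ x : p', ∃ hx : φ x ∈ p, ρ' x = ρ ⟨φ x, hx⟩)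
    {z : UniversalEnvelopingAlgebra K L' ⊗[K] W} (hz : z ∈ indRel p' ρ') :
    preMap φ p ρ z = 0 := by
  have hp : ∀ x : p', φ x ∈ p := fun x => (h x).1
  let ψ : p' →ₗ⁅K⁆ p :=
    { toFun := fun x => ⟨φ x, hp x⟩
      map_add' := fun x y => by ext; simp
      map_smul' := fun c x => by ext; simp
      map_lie' := fun {x y} => by ext; simp }
  have h1 : (envMap φ).comp (envMap p'.incl) = (envMap p.incl).comp (envMap ψ) := by
    apply UniversalEnvelopingAlgebra.hom_ext
    ext x
    simp [envMap_ι, ψ, -UniversalEnvelopingAlgebra.ι_apply]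
  have h2 : (UniversalEnvelopingAlgebra.lift K ρ).comp (envMap ψ) =
      UniversalEnvelopingAlgebra.lift K ρ' := by
    apply UniversalEnvelopingAlgebra.hom_ext
    ext x : 1
    simp only [LieHom.comp_apply, AlgHom.toLieHom_apply, AlgHom.comp_apply, envMap_ι,
      UniversalEnvelopingAlgebra.lift_ι_apply]
    exact (h x).2.symm
  induction hz using Submodule.span_induction with
  | zero => simp
  | add a b _ _ ha hb => simp only [map_add, ha, hb, add_zero]
  | smul u a _ ha => rw [preMap_smul, ha, smul_zero]
  | mem z hz =>
    obtain ⟨u, a, w, rfl⟩ := hz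
    have e1 : envMap φ (envMap p'.incl a) = envMap p.incl (envMap ψ a) := DFunLike.congr_fun h1 a
    have e2 : UniversalEnvelopingAlgebra.lift K ρ' a =
        UniversalEnvelopingAlgebra.lift K ρ (envMap ψ a) := (DFunLike.congr_fun h2 a).symm
    simp only [preMap, LinearMap.comp_apply, map_sub, TensorProduct.map_tmul,
      AlgHom.toLinearMap_apply, map_mul, LinearMap.restrictScalars_apply, LinearMap.id_apply, e1,
      e2]
    rw [← map_sub]
    exact (Submodule.Quotient.mk_eq_zero _).2 (Submodule.subset_span ⟨_, _, _, rfl⟩)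

/-- Let `φ : L' → L` map the subalgebra `p'` into `p`, and let the representation `ρ'` of `p'` in
`W` be the pull-back of the representation `ρ` of `p` in `W`. This is the natural map
`U(L') ⊗_{U(p')} W → U(L) ⊗_{U(p)} W`, `u ⊗ w ↦ U(φ)(u) ⊗ w`. -/
def map (φ : L' →ₗ⁅K⁆ L) (h : ∀ x : p', ∃ hx : φ x ∈ p, ρ' x = ρ ⟨φ x, hx⟩) :
    Ind p' ρ' →ₗ[K] Ind p ρ :=
  Submodule.liftQ ((indRel p' ρ').restrictScalars K) (preMap φ p ρ)
    (fun _ hz => preMap_eq_zero φ h hz)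

theorem map_smul' (φ : L' →ₗ⁅K⁆ L) (h : ∀ x : p', ∃ hx : φ x ∈ p, ρ' x = ρ ⟨φ x, hx⟩)
    (u : UniversalEnvelopingAlgebra K L') (m : Ind p' ρ') :
    map φ h (u • m) = envMap φ u • map φ h m := by
  obtain ⟨z, rfl⟩ := Submodule.Quotient.mk_surjective (indRel p' ρ') m
  exact preMap_smul φ u z

end Ind

end Induction

/-- A filtration of length `k` on a Lie algebra `L`: a chain of ideals
`L = L_0 ⊇ L_1 ⊇ ... ⊇ L_k = 0` such that the codimension of `L_{i+1}` in `L_i` is at most one.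
Ideals may be repeated. -/
structure LieFiltration (K : Type*) [Field K] (L : Type*) [LieRing L] [LieAlgebra K L]
    (k : ℕ) where
  /-- The ideals of the chain. -/
  ideal : Fin (k + 1) → LieIdeal K L
  antitone : Antitone ideal
  ideal_zero : ideal 0 = ⊤
  ideal_last : ideal (Fin.last k) = ⊥
  codim_le_one : ∀ i : Fin k,
    Module.rank K (↥(ideal i.castSucc).toSubmodule ⧸
      (ideal i.succ).toSubmodule.submoduleOf (ideal i.castSucc).toSubmodule) ≤ 1

namespace LieFiltration

variable {K : Type*} [Field K] {L : Type*} [LieRing L] [LieAlgebra K L] {k : ℕ}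

/-- The filtration `I ∩ L_0 ⊇ I ∩ L_1 ⊇ ... ⊇ I ∩ L_k` induced on an ideal `I` of `L`. -/
def restrict (s : LieFiltration K L k) (I : LieIdeal K L) : LieFiltration K I k where
  ideal j := (s.ideal j).comap I.incl
  antitone _ _ h := LieIdeal.comap_mono (s.antitone h)
  ideal_zero := by rw [s.ideal_zero]; ext x; simp
  ideal_last := by rw [s.ideal_last]; ext x; simp
  codim_le_one j := by
    refine le_trans ?_ (s.codim_le_one j)
    let g : ↥((s.ideal j.castSucc).comap I.incl).toSubmodule →ₗ[K]
        ↥(s.ideal j.castSucc).toSubmodule :=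
      { toFun := fun x => ⟨I.incl x.1, x.2⟩
        map_add' := fun _ _ => rfl
        map_smul' := fun _ _ => rfl }
    refine LinearMap.rank_le_of_injective (Submodule.mapQ _ _ g fun _ hx => hx) ?_
    rw [injective_iff_map_eq_zero]
    intro a ha
    obtain ⟨x, rfl⟩ := Submodule.Quotient.mk_surjective _ a
    have hx : g x ∈ (s.ideal j.succ).toSubmodule.submoduleOf (s.ideal j.castSucc).toSubmodule :=
      (Submodule.Quotient.mk_eq_zero _).1 ha
    exact (Submodule.Quotient.mk_eq_zero _).2 hx

/-- The stabilizer `{x ∈ L_i | f([x, L_i]) = 0}` of `f_i = f|_{L_i}` in `L_i`. -/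
def stabilizer (s : LieFiltration K L k) (f : Module.Dual K L) (i : Fin (k + 1)) :
    Submodule K L where
  carrier := {x | x ∈ s.ideal i ∧ ∀ y ∈ s.ideal i, f ⁅x, y⁆ = 0}
  add_mem' {a b} ha hb := ⟨add_mem ha.1 hb.1, fun y hy => by
    rw [add_lie, map_add, ha.2 y hy, hb.2 y hy, add_zero]⟩
  zero_mem' := ⟨zero_mem _, fun y _ => by rw [zero_lie, map_zero]⟩
  smul_mem' c a ha := ⟨(s.ideal i).smul_mem c ha.1, fun y hy => by
    rw [smul_lie, map_smul, ha.2 y hy, smul_zero]⟩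

theorem lie_mem_stabilizer (s : LieFiltration K L k) (f : Module.Dual K L) {i j : Fin (k + 1)}
    (hij : i ≤ j) {x y : L} (hx : x ∈ s.stabilizer f i) (hy : y ∈ s.stabilizer f j) :
    ⁅x, y⁆ ∈ s.stabilizer f j := by
  refine ⟨lie_mem_right K L _ x y hy.1, fun z hz => ?_⟩
  rw [lie_lie, map_sub, hx.2 _ (s.antitone hij (lie_mem_right K L _ y z hz)),
    hy.2 _ (lie_mem_right K L _ x z hz), sub_zero]

/-- The Vergne polarization `pv(f) = ∑_i L_i^{f_i}`. -/
def vergne (s : LieFiltration K L k) (f : Module.Dual K L) : LieSubalgebra K L where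
  toSubmodule := ⨆ i, s.stabilizer f i
  lie_mem' {x y} hx hy := by
    change x ∈ ⨆ i, s.stabilizer f i at hx
    change y ∈ ⨆ i, s.stabilizer f i at hy
    change ⁅x, y⁆ ∈ ⨆ i, s.stabilizer f i
    induction hx using Submodule.iSup_induction' with
    | zero => rw [zero_lie]; exact zero_mem _
    | add a b _ _ ha hb => rw [add_lie]; exact add_mem ha hb
    | mem i x hx =>
      induction hy using Submodule.iSup_induction' with
      | zero => rw [lie_zero]; exact zero_mem _
      | add a b _ _ ha hb => rw [lie_add]; exact add_mem ha hb
      | mem j y hy =>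
        rcases le_total i j with h | h
        · exact Submodule.mem_iSup_of_mem j (s.lie_mem_stabilizer f h hx hy)
        · rw [← lie_skew]
          exact neg_mem (Submodule.mem_iSup_of_mem i (s.lie_mem_stabilizer f h hy hx))

theorem apply_lie_of_mem_vergne (s : LieFiltration K L k) (f : Module.Dual K L) {x y : L}
    (hx : x ∈ s.vergne f) (hy : y ∈ s.vergne f) : f ⁅x, y⁆ = 0 := by
  change x ∈ ⨆ i, s.stabilizer f i at hx
  change y ∈ ⨆ i, s.stabilizer f i at hy
  induction hx using Submodule.iSup_induction' with
  | zero => rw [zero_lie, map_zero]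
  | add a b _ _ ha hb => rw [add_lie, map_add, ha, hb, add_zero]
  | mem i x hx =>
    induction hy using Submodule.iSup_induction' with
    | zero => rw [lie_zero, map_zero]
    | add a b _ _ ha hb => rw [lie_add, map_add, ha, hb, add_zero]
    | mem j y hy =>
      rcases le_total i j with h | h
      · exact hx.2 y (s.antitone h hy.1)
      · rw [← lie_skew, map_neg, hy.2 x (s.antitone h hx.1), neg_zero]

section

attribute [local instance 100] LieRing.ofAssociativeRing

/-- The one-dimensional representation of the Vergne polarization `pv(f)` in the space `K`
in which `x` acts as multiplication by `f(x)`. -/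
def character (s : LieFiltration K L k) (f : Module.Dual K L) :
    s.vergne f →ₗ⁅K⁆ Module.End K K where
  toFun x := f x • LinearMap.id
  map_add' x y := by simp [add_smul]
  map_smul' c x := by simp [mul_smul]
  map_lie' {x y} := by
    rw [LieSubalgebra.coe_bracket, s.apply_lie_of_mem_vergne f x.2 y.2]
    ext
    simp [LieRing.of_associative_ring_bracket, mul_comm]

end

/-- The module `M(f) = U(L) ⊗_{U(pv(f))} K` induced by the restriction of `f` to `pv(f)`. -/
abbrev M (s : LieFiltration K L k) (f : Module.Dual K L) : Type _ :=
  Ind (s.vergne f) (s.character f)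

/-- The restriction of `f` to an ideal. -/
abbrev res (f : Module.Dual K L) (I : LieIdeal K L) : Module.Dual K I :=
  f.comp I.incl.toLinearMap

theorem mem_vergne_of_mem_restrict (s : LieFiltration K L k) (f : Module.Dual K L)
    (i : Fin (k + 1)) {x : s.ideal i}
    (hx : x ∈ (s.restrict (s.ideal i)).vergne (res f (s.ideal i))) :
    (x : L) ∈ s.vergne f := by
  change x ∈ ⨆ j, (s.restrict (s.ideal i)).stabilizer (res f (s.ideal i)) j at hx
  change (x : L) ∈ ⨆ j, s.stabilizer f j
  induction hx using Submodule.iSup_induction' with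
  | zero => exact zero_mem _
  | add a b _ _ ha hb => exact add_mem ha hb
  | mem j x hx =>
    rcases le_total i j with h | h
    · refine Submodule.mem_iSup_of_mem j ⟨hx.1, fun y hy => ?_⟩
      exact hx.2 ⟨y, s.antitone h hy⟩ hy
    · refine Submodule.mem_iSup_of_mem i ⟨x.2, fun y hy => ?_⟩
      exact hx.2 ⟨y, hy⟩ (s.antitone h hy)

/-- The natural map `M_i(f_i) → M(f)`, where `M_i(f_i)` is the `U(L_i)`-module induced by the
restriction of `f_i = f|_{L_i}` to its Vergne polarization with respect to the filtration induced
on `L_i`. -/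
def stepMap (s : LieFiltration K L k) (f : Module.Dual K L) (i : Fin (k + 1)) :
    (s.restrict (s.ideal i)).M (res f (s.ideal i)) →ₗ[K] s.M f :=
  Ind.map (s.ideal i).incl (fun x => ⟨s.mem_vergne_of_mem_restrict f i x.2, rfl⟩)

/-- A `U(L, s)`-module structure on a representation `V` of `L`: a chain of subspaces
`V = V_0 ⊇ V_1 ⊇ ... ⊇ V_k` such that `V_i` is invariant under `L_i`. -/
structure FilteredModule (s : LieFiltration K L k) (V : Type*) [AddCommGroup V] [Module K V]
    [LieRingModule L V] [LieModule K L V] where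
  /-- The subspaces of the chain; `V_i` is a representation of `L_i`. -/
  sub : ∀ i : Fin (k + 1), LieSubmodule K (s.ideal i) V
  antitone : Antitone fun i => (sub i).toSubmodule
  sub_zero : (sub 0).toSubmodule = ⊤

namespace FilteredModule

variable {s : LieFiltration K L k}
variable {V : Type*} [AddCommGroup V] [Module K V] [LieRingModule L V] [LieModule K L V]
variable {V' : Type*} [AddCommGroup V'] [Module K V'] [LieRingModule L V'] [LieModule K L V']

/-- `(V, s)` is irreducible if every `V_i` is an irreducible representation of `L_i`. -/
def IsIrreducible (F : s.FilteredModule V) : Prop :=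
  ∀ i, LieModule.IsIrreducible K (s.ideal i) (F.sub i)

/-- Equivalence of `(V, s)` and `(V', s)`: an isomorphism `C : V → V'` of representations of `L`
with `C(V_i) = V'_i` for all `i`. -/
def Equivalent (F : s.FilteredModule V) (F' : s.FilteredModule V') : Prop :=
  ∃ C : V ≃ₗ⁅K,L⁆ V', ∀ i,
    (F.sub i).toSubmodule.map (C : V →ₗ[K] V') = (F'.sub i).toSubmodule

end FilteredModule

theorem mem_range_stepMap (s : LieFiltration K L k) (f : Module.Dual K L) (i : Fin (k + 1))
    (m : s.M f) : m ∈ LinearMap.range (s.stepMap f i) ↔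
      ∃ u, Ind.mk (s.vergne f) (s.character f) (envMap (s.ideal i).incl u ⊗ₜ[K] 1) = m := by
  constructor
  · rintro ⟨m, rfl⟩
    obtain ⟨z, rfl⟩ := Submodule.Quotient.mk_surjective _ m
    obtain ⟨u, rfl⟩ := (TensorProduct.rid K _).symm.surjective z
    exact ⟨u, rfl⟩
  · rintro ⟨u, rfl⟩
    exact ⟨Ind.mk _ _ (u ⊗ₜ[K] 1), rfl⟩

theorem stepMap_range_mono (s : LieFiltration K L k) (f : Module.Dual K L) {i j : Fin (k + 1)}
    (h : i ≤ j) : LinearMap.range (s.stepMap f j) ≤ LinearMap.range (s.stepMap f i) := by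
  intro m hm
  rw [mem_range_stepMap] at hm ⊢
  obtain ⟨u, rfl⟩ := hm
  refine ⟨envMap (LieIdeal.inclusion (s.antitone h)) u, ?_⟩
  rw [envMap_envMap]
  rfl

theorem stepMap_range_zero (s : LieFiltration K L k) (f : Module.Dual K L) :
    LinearMap.range (s.stepMap f 0) = ⊤ := by
  rw [eq_top_iff]
  rintro m -
  rw [mem_range_stepMap]
  obtain ⟨z, rfl⟩ := Submodule.Quotient.mk_surjective _ m
  obtain ⟨u, rfl⟩ := (TensorProduct.rid K _).symm.surjective z
  let ψ : L →ₗ⁅K⁆ s.ideal 0 :=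
    { toFun := fun x => ⟨x, by rw [s.ideal_zero]; trivial⟩
      map_add' := fun _ _ => rfl
      map_smul' := fun _ _ => rfl
      map_lie' := fun {_ _} => rfl }
  refine ⟨envMap ψ u, ?_⟩
  rw [envMap_envMap, show (s.ideal 0).incl.comp ψ = LieHom.id from rfl, envMap_id]
  rfl

/-- The `U(L, s)`-module `M_s(f)`: the module `M(f)` with the chain of subspaces
`M(f) = M_0(f_0) ⊇ M_1(f_1) ⊇ ... ⊇ M_k(f_k)`. -/
def Ms (s : LieFiltration K L k) (f : Module.Dual K L) : s.FilteredModule (s.M f) where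
  sub i :=
    { toSubmodule := LinearMap.range (s.stepMap f i)
      lie_mem := by
        rintro x _ ⟨m, rfl⟩
        refine ⟨UniversalEnvelopingAlgebra.ι K x • m, ?_⟩
        rw [stepMap, Ind.map_smul', envMap_ι]
        rfl }
  antitone _ _ h := s.stepMap_range_mono f h
  sub_zero := s.stepMap_range_zero f

end LieFiltration

end

/-! For a subalgebra H, `weightSpace` consists of the vectors on which the radicals of the forms
f([x, y]) on the H ∩ L_i act through f. For H = L_i this says that the Vergne polarization of f_i
acts through f. Everything rests on `hull_inf_weightSpace`: in the H-module generated by a space E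
of weight vectors, all weight vectors lie in E and every nonzero submodule meets E.

This is a Weyl algebra argument. If f([H, H]) ≠ 0, take the last j with f([H, H ∩ L_j]) ≠ 0, and y
in H ∩ L_j, q in H with f([q, y]) ≠ 0. The orthogonal H' of y is a subalgebra of codimension one, y
acts as f(y) on the H'-module B generated by E, and the H-module is the sum of the q^n B. There y -
f(y) behaves like differentiation in q, so in characteristic 0 its kernel is B, and induction on dim
H applies.

Irreducibility: M_i(f_i) is the L_i-module generated by 1 ⊗ 1, so each nonzero submodule contains 1
⊗ 1. That 1 ⊗ 1 ≠ 0 (`gen_ne_zero`) follows by constructing, up the chain, representations with a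
nonzero vector satisfying the same relations.

Surjectivity: a nonzero v in V_k lies in every V_i, and f is built up the chain so that v remains a
weight vector. An element x of the stabilizer in L_i outside L_{i+1} acts on the L_{i+1}-weight
vectors of V_i without proper nonzero invariant subspaces, hence by a scalar, which is taken as
f(x). Then 1 ⊗ 1 ↦ v defines an isomorphism. -/

noncomputable section

namespace LieFiltration

variable {K : Type*} [Field K] {L : Type*} [LieRing L] [LieAlgebra K L] {k : ℕ}

/-! ### Vectors and linear forms adapted to the chain of ideals -/

section Filtration

variable (s : LieFiltration K L k)

/-- A vector of `L_i` outside `L_{i+1}` spans `L_i` modulo `L_{i+1}`. -/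
theorem exists_sub_smul_mem (i : Fin k) {x u : L} (hx : x ∈ s.ideal i.castSucc)
    (hx' : x ∉ s.ideal i.succ) (hu : u ∈ s.ideal i.castSucc) :
    ∃ c : K, u - c • x ∈ s.ideal i.succ := by
  obtain ⟨v, hv⟩ := rank_le_one_iff.1 (s.codim_le_one i)
  obtain ⟨r, hr⟩ := hv (Submodule.Quotient.mk ⟨x, hx⟩)
  obtain ⟨t, ht⟩ := hv (Submodule.Quotient.mk ⟨u, hu⟩)
  have hr0 : r ≠ 0 := by
    rintro rfl
    rw [zero_smul] at hr
    have h : (⟨x, hx⟩ : ↥(s.ideal i.castSucc).toSubmodule) ∈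
      (s.ideal i.succ).toSubmodule.submoduleOf (s.ideal i.castSucc).toSubmodule :=
      (Submodule.Quotient.mk_eq_zero _).1 hr.symm
    exact hx' h
  refine ⟨t / r, ?_⟩
  have h : (Submodule.Quotient.mk (⟨u, hu⟩ - (t / r) • ⟨x, hx⟩) :
      ↥(s.ideal i.castSucc).toSubmodule ⧸
      (s.ideal i.succ).toSubmodule.submoduleOf (s.ideal i.castSucc).toSubmodule) = 0 := by
    rw [Submodule.Quotient.mk_sub, Submodule.Quotient.mk_smul, ← hr, ← ht, smul_smul,
      div_mul_cancel₀ _ hr0, sub_self]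
  have h' : (⟨u, hu⟩ - (t / r) • ⟨x, hx⟩ : ↥(s.ideal i.castSucc).toSubmodule) ∈
    (s.ideal i.succ).toSubmodule.submoduleOf (s.ideal i.castSucc).toSubmodule :=
    (Submodule.Quotient.mk_eq_zero _).1 h
  exact h'

/-- The quotient `L_i / L_{i+1}` is abelian. -/
theorem lie_mem_ideal_succ (i : Fin k) {x y : L} (hx : x ∈ s.ideal i.castSucc)
    (hy : y ∈ s.ideal i.castSucc) : ⁅x, y⁆ ∈ s.ideal i.succ := by
  by_cases hx' : x ∈ s.ideal i.succ
  · exact lie_mem_left K L _ x y hx'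
  obtain ⟨c, hc⟩ := s.exists_sub_smul_mem i hx hx' hy
  have h : ⁅x, y⁆ = ⁅x, y - c • x⁆ := by simp
  rw [h]
  exact lie_mem_right K L _ x _ hc

/-- Allows the induction on dim H in `hull_inf_weightSpace`. -/
theorem finite_of_filtration (s : LieFiltration K L k) : Module.Finite K L := by
  have h : ∀ i, (s.ideal i).toSubmodule.FG := by
    intro i
    induction i using Fin.reverseInduction with
    | last => rw [s.ideal_last]; exact Submodule.fg_bot
    | cast i ih =>
      by_cases hi : s.ideal i.castSucc ≤ s.ideal i.succ
      · rw [le_antisymm hi (s.antitone i.castSucc_lt_succ.le)]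
        exact ih
      obtain ⟨x, hx, hx'⟩ := SetLike.not_le_iff_exists.1 hi
      have : (s.ideal i.castSucc).toSubmodule = (s.ideal i.succ).toSubmodule ⊔ K ∙ x := by
        apply le_antisymm
        · intro u hu
          obtain ⟨c, hc⟩ := s.exists_sub_smul_mem i hx hx' hu
          exact Submodule.mem_sup.2 ⟨_, hc, _,
            Submodule.smul_mem _ c (Submodule.mem_span_singleton_self x), sub_add_cancel _ _⟩
        · refine sup_le (s.antitone i.castSucc_lt_succ.le) ?_
          rw [Submodule.span_singleton_le_iff_mem]
          exact hx
      rw [this]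
      exact ih.sup (Submodule.fg_span_singleton x)
  have := h 0
  rw [s.ideal_zero] at this
  exact ⟨this⟩

/-- A linear form which vanishes on `L_{i+1}` and is `1` at a given vector outside `L_{i+1}`. -/
theorem exists_dual_eq_one (i : Fin k) {x : L} (hx' : x ∉ s.ideal i.succ) :
    ∃ l : Module.Dual K L, l x = 1 ∧ ∀ y ∈ s.ideal i.succ, l y = 0 := by
  obtain ⟨l, hl, hl'⟩ := Submodule.exists_dual_map_eq_bot_of_notMem
    (p := (s.ideal i.succ).toSubmodule) hx' inferInstance
  refine ⟨(l x)⁻¹ • l, by simp [hl], fun y hy => ?_⟩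
  have : l y ∈ (s.ideal i.succ).toSubmodule.map l := Submodule.mem_map_of_mem hy
  rw [hl', Submodule.mem_bot] at this
  simp [this]

theorem sub_smul_mem_of_dual (i : Fin k) {x u : L} (hx : x ∈ s.ideal i.castSucc)
    (hx' : x ∉ s.ideal i.succ) {l : Module.Dual K L} (hl : l x = 1)
    (hl' : ∀ y ∈ s.ideal i.succ, l y = 0) (hu : u ∈ s.ideal i.castSucc) :
    u - l u • x ∈ s.ideal i.succ := by
  obtain ⟨c, hc⟩ := s.exists_sub_smul_mem i hx hx' hu
  have h := hl' _ hc
  rw [map_sub, map_smul, hl, smul_eq_mul, mul_one, sub_eq_zero] at h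
  rwa [h]

theorem mem_stabilizer_succ (f : Module.Dual K L) (i : Fin k) {x : L}
    (hx : x ∈ s.stabilizer f i.castSucc) (hx' : x ∈ s.ideal i.succ) :
    x ∈ s.stabilizer f i.succ :=
  ⟨hx', fun y hy => hx.2 y (s.antitone i.castSucc_lt_succ.le hy)⟩

end Filtration

/-! ### Generated submodules, weight vectors and the degree in q -/

section Hull

variable {M : Type*} [AddCommGroup M] [Module K M] [LieRingModule L M]

/-- The smallest subspace of `M` which contains `E` and is invariant under `H`. -/
def hull (H : LieSubalgebra K L) (E : Submodule K M) : Submodule K M :=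
  sInf {N | E ≤ N ∧ ∀ x ∈ H, ∀ m ∈ N, ⁅x, m⁆ ∈ N}

variable (H : LieSubalgebra K L) (E : Submodule K M)

theorem le_hull : E ≤ hull H E := le_sInf fun _ h => h.1

theorem lie_mem_hull {x : L} (hx : x ∈ H) {m : M} (hm : m ∈ hull H E) : ⁅x, m⁆ ∈ hull H E := by
  rw [hull, Submodule.mem_sInf] at hm ⊢
  exact fun N hN => hN.2 x hx m (hm N hN)

variable {H E}

theorem hull_le {N : Submodule K M} (hE : E ≤ N) (hN : ∀ x ∈ H, ∀ m ∈ N, ⁅x, m⁆ ∈ N) :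
    hull H E ≤ N :=
  sInf_le ⟨hE, hN⟩

variable [LieModule K L M]

/-- The space of vectors on which, for each `i`, the stabilizer of `f` in `H ∩ L_i` acts
through `f`. -/
def weightSpace (s : LieFiltration K L k) (f : Module.Dual K L) (M : Type*) [AddCommGroup M]
    [Module K M] [LieRingModule L M] [LieModule K L M] (H : LieSubalgebra K L) :
    Submodule K M where
  carrier := {m | ∀ i, ∀ x ∈ H, x ∈ s.ideal i → (∀ y ∈ H, y ∈ s.ideal i → f ⁅x, y⁆ = 0) →
    ⁅x, m⁆ = f x • m}
  add_mem' {a b} ha hb i x h1 h2 h3 := by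
    rw [lie_add, ha i x h1 h2 h3, hb i x h1 h2 h3, smul_add]
  zero_mem' i x _ _ _ := by simp
  smul_mem' c a ha i x h1 h2 h3 := by
    rw [lie_smul, ha i x h1 h2 h3, smul_comm]

/-- The subspaces `P_0 = 0`, `P_{n+1} = B + P_n + q P_n`. -/
def tower (q : L) (B : Submodule K M) : ℕ → Submodule K M
  | 0 => ⊥
  | n + 1 => B ⊔ tower q B n ⊔ (tower q B n).map (LieModule.toEnd K L M q)

variable {q : L} {B : Submodule K M}

theorem tower_le_succ (n : ℕ) : tower q B n ≤ tower q B (n + 1) :=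
  le_trans le_sup_right le_sup_left

theorem le_tower_succ (n : ℕ) : B ≤ tower q B (n + 1) := le_trans le_sup_left le_sup_left

theorem lie_mem_tower_succ {n : ℕ} {m : M} (hm : m ∈ tower q B n) :
    ⁅q, m⁆ ∈ tower q B (n + 1) :=
  Submodule.mem_sup_right ⟨m, hm, rfl⟩

theorem tower_one : tower q B 1 = B := by simp [tower]

theorem tower_mono : Monotone (tower q B) := monotone_nat_of_le_succ tower_le_succ

theorem exists_of_mem_tower_succ {n : ℕ} {w : M} (hw : w ∈ tower q B (n + 1)) :
    ∃ b ∈ B, ∃ w₁ ∈ tower q B n, ∃ w₂ ∈ tower q B n, w = b + w₁ + ⁅q, w₂⁆ := by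
  obtain ⟨y, hy, z, hz, rfl⟩ := Submodule.mem_sup.1 hw
  obtain ⟨b, hb, w₁, hw₁, rfl⟩ := Submodule.mem_sup.1 hy
  obtain ⟨w₂, hw₂, rfl⟩ := hz
  exact ⟨b, hb, w₁, hw₁, w₂, hw₂, rfl⟩

/-- If `H'` and `q` span `H`, then the union of the tower over the `H'`-invariant hull of `E` is the
`H`-invariant hull of `E`. -/
theorem exists_mem_tower {H' : LieSubalgebra K L} (hH' : H' ≤ H) (hq : q ∈ H)
    (hspan : ∀ u ∈ H, ∃ c : K, u - c • q ∈ H') {m : M} (hm : m ∈ hull H E) :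
    ∃ n, m ∈ tower q (hull H' E) n := by
  -- Moving u past q costs [u, q], which lies in H' + K q; both parts stay in the same level.
  have hstep : ∀ n, ∀ u ∈ H', ∀ m ∈ tower q (hull H' E) n, ⁅u, m⁆ ∈ tower q (hull H' E) n := by
    intro n
    induction n with
    | zero =>
      intro u _ m hm
      rw [tower, Submodule.mem_bot] at hm
      rw [hm, lie_zero]
      exact zero_mem _
    | succ n ih =>
      intro u hu m hm
      obtain ⟨b, hb, w₁, hw₁, w₂, hw₂, rfl⟩ := exists_of_mem_tower_succ hm
      obtain ⟨c, hc⟩ := hspan ⁅u, q⁆ (H.lie_mem (hH' hu) hq)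
      have h : ⁅u, b + w₁ + ⁅q, w₂⁆⁆ =
          ⁅u, b⁆ + ⁅u, w₁⁆ + (⁅⁅u, q⁆ - c • q, w₂⁆ + c • ⁅q, w₂⁆ + ⁅q, ⁅u, w₂⁆⁆) := by
        rw [lie_add, lie_add, leibniz_lie u q w₂, sub_lie, smul_lie, sub_add_cancel]
      rw [h]
      exact add_mem (add_mem (le_tower_succ n (lie_mem_hull _ _ hu hb))
        (tower_le_succ n (ih u hu _ hw₁)))
        (add_mem (add_mem (tower_le_succ n (ih _ hc _ hw₂))
          (Submodule.smul_mem _ c (lie_mem_tower_succ hw₂))) (lie_mem_tower_succ (ih u hu _ hw₂)))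
  have hle : hull H E ≤ ⨆ n, tower q (hull H' E) n := by
    refine hull_le ?_ ?_
    · exact le_trans (le_trans (le_hull H' E) (le_tower_succ 0)) (le_iSup (tower q (hull H' E)) 1)
    · intro x hx m hm
      rw [Submodule.mem_iSup_of_directed _ tower_mono.directed_le] at hm ⊢
      obtain ⟨n, hn⟩ := hm
      obtain ⟨c, hc⟩ := hspan x hx
      refine ⟨n + 1, ?_⟩
      have h : ⁅x, m⁆ = ⁅x - c • q, m⁆ + c • ⁅q, m⁆ := by
        rw [sub_lie, smul_lie, sub_add_cancel]
      rw [h]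
      exact add_mem (tower_le_succ n (hstep n _ hc _ hn))
        (Submodule.smul_mem _ c (lie_mem_tower_succ hn))
  exact (Submodule.mem_iSup_of_directed _ tower_mono.directed_le).1 (hle hm)

/-- An operator `Y` with `Y B = 0` and `Y q = q Y - c Y - a` lowers the degree in the tower over
`B`, and `q Y` acts in degree `n` as the scalar `-n a`. -/
theorem lowering_tower {Y : Module.End K M} {a c : K} {P : Submodule K M}
    (hY : ∀ b ∈ B, Y b = 0) (hP : ∀ n, tower q B n ≤ P)
    (hq : ∀ m ∈ P, Y ⁅q, m⁆ = ⁅q, Y m⁆ - c • Y m - a • m) (n : ℕ) :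
    ∀ w ∈ tower q B (n + 1), Y w ∈ tower q B n ∧
      ⁅q, Y w⁆ + (n : K) • a • w ∈ tower q B n := by
  induction n with
  | zero =>
    intro w hw
    rw [tower_one] at hw
    simp [hY w hw]
  | succ n ih =>
    intro w hw
    obtain ⟨b, hb, w₁, hw₁, w₂, hw₂, rfl⟩ := exists_of_mem_tower_succ hw
    obtain ⟨h1, h1'⟩ := ih _ hw₁
    obtain ⟨h2, h2'⟩ := ih _ hw₂
    have e : Y (b + w₁ + ⁅q, w₂⁆) = Y w₁ + (⁅q, Y w₂⁆ - c • Y w₂ - a • w₂) := by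
      rw [map_add, map_add, hY b hb, zero_add, hq _ (hP _ hw₂)]
    have h3 : Y (b + w₁ + ⁅q, w₂⁆) ∈ tower q B (n + 1) := by
      rw [e]
      exact add_mem (tower_le_succ n h1) (sub_mem (sub_mem (lie_mem_tower_succ h2)
        (Submodule.smul_mem _ c (tower_le_succ n h2))) (Submodule.smul_mem _ a hw₂))
    refine ⟨h3, ?_⟩
    -- By induction q Y w₂ is -n a w₂ up to lower degree; the term -a w₂ of Y q w₂ turns n into n +
    -- 1.
    have e2 : ⁅q, Y (b + w₁ + ⁅q, w₂⁆)⁆ + ((n + 1 : ℕ) : K) • a • (b + w₁ + ⁅q, w₂⁆) =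
        ⁅q, Y w₁⁆ + ⁅q, ⁅q, Y w₂⁆ + (n : K) • a • w₂⁆ - c • ⁅q, Y w₂⁆ +
          ((n + 1 : ℕ) : K) • a • (b + w₁) := by
      rw [e]
      simp only [lie_add, lie_sub, lie_smul, Nat.cast_add, Nat.cast_one, smul_add, add_smul,
        one_smul]
      abel
    rw [e2]
    exact add_mem (sub_mem (add_mem (lie_mem_tower_succ h1) (lie_mem_tower_succ h2'))
      (Submodule.smul_mem _ c (lie_mem_tower_succ h2)))
      (Submodule.smul_mem _ _ (Submodule.smul_mem _ _ (add_mem (le_tower_succ n hb) hw₁)))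

/-- On P_{n+2} the operator q Y is the scalar -(n+1) a modulo P_{n+1}, and this scalar is invertible
in characteristic 0. -/
theorem mem_tower_of_lowering_eq_zero [CharZero K] {Y : Module.End K M} {a c : K} (ha : a ≠ 0)
    {P : Submodule K M} (hY : ∀ b ∈ B, Y b = 0) (hP : ∀ n, tower q B n ≤ P)
    (hq : ∀ m ∈ P, Y ⁅q, m⁆ = ⁅q, Y m⁆ - c • Y m - a • m) {n : ℕ} {w : M}
    (hw : w ∈ tower q B (n + 2)) (hw0 : Y w = 0) : w ∈ tower q B (n + 1) := by
  have h := (lowering_tower hY hP hq (n + 1) w hw).2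
  rw [hw0, lie_zero, zero_add, smul_smul] at h
  have hne : ((n + 1 : ℕ) : K) * a ≠ 0 := mul_ne_zero (Nat.cast_ne_zero.2 n.succ_ne_zero) ha
  exact (Submodule.smul_mem_iff _ hne).1 h

end Hull

end LieFiltration

end

/-! ### Weight vectors in the module generated by weight vectors -/

noncomputable section

namespace LieFiltration

variable {K : Type*} [Field K] {L : Type*} [LieRing L] [LieAlgebra K L] {k : ℕ}
variable {M : Type*} [AddCommGroup M] [Module K M] [LieRingModule L M] [LieModule K L M]

theorem exists_lie_eq (s : LieFiltration K L k) {H : LieSubalgebra K L} {j : Fin k} {y : L}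
    (hyH : y ∈ H) (hy : y ∈ s.ideal j.castSucc) (hy' : y ∉ s.ideal j.succ) {u : L} (hu : u ∈ H) :
    ∃ (c : K) (b : L), b ∈ H ∧ b ∈ s.ideal j.succ ∧ ⁅u, y⁆ = c • y + b := by
  obtain ⟨c, hc⟩ := s.exists_sub_smul_mem j hy hy' (lie_mem_right K L _ u y hy)
  exact ⟨c, _, sub_mem (H.lie_mem hu hyH) (H.smul_mem c hyH), hc, by abel⟩

/-- Let `f` vanish on `[H, H ∩ L_{j+1}]`. For `y ∈ H ∩ L_j` outside `L_{j+1}`, this is the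
subalgebra `{u ∈ H | f([u, y]) = 0}`. -/
def orthogonal (s : LieFiltration K L k) (f : Module.Dual K L) (H : LieSubalgebra K L) (j : Fin k)
    (y : L) (hyH : y ∈ H) (hy : y ∈ s.ideal j.castSucc) (hy' : y ∉ s.ideal j.succ)
    (hf : ∀ u ∈ H, ∀ b ∈ H, b ∈ s.ideal j.succ → f ⁅u, b⁆ = 0) : LieSubalgebra K L where
  carrier := {u | u ∈ H ∧ f ⁅u, y⁆ = 0}
  add_mem' {a b} ha hb := ⟨add_mem ha.1 hb.1, by rw [add_lie, map_add, ha.2, hb.2, add_zero]⟩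
  zero_mem' := ⟨zero_mem _, by rw [zero_lie, map_zero]⟩
  smul_mem' c a ha := ⟨H.smul_mem c ha.1, by rw [smul_lie, map_smul, ha.2, smul_zero]⟩
  lie_mem' {u u'} hu hu' := by
    refine ⟨H.lie_mem hu.1 hu'.1, ?_⟩
    -- Modulo H ∩ L_{j+1}, whose brackets with H are killed by f, y is an eigenvector of ad u and ad
    -- u'.
    obtain ⟨c, b, hbH, hb, h⟩ := s.exists_lie_eq hyH hy hy' hu.1
    obtain ⟨c', b', hbH', hb', h'⟩ := s.exists_lie_eq hyH hy hy' hu'.1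
    rw [lie_lie, h, h', lie_add, lie_add, lie_smul, lie_smul]
    simp [hu.2, hu'.2, hf u hu.1 b' hbH' hb', hf u' hu'.1 b hbH hb]

/-- A u in the radical on H' ∩ L_i may pair nontrivially with some r in H ∩ L_i. Such an r is
outside H', so f([r, y]) ≠ 0; as y is orthogonal to H ∩ L_j, this forces i ≤ j and y ∈ L_i. For a
suitable b, u - b y is orthogonal to r and to H' ∩ L_i, which together span H ∩ L_i. Now u - b y and
y both act through f, hence so does u. -/
theorem weightSpace_le_of_orthogonal (s : LieFiltration K L k) (f : Module.Dual K L)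
    (H : LieSubalgebra K L) (j : Fin k)
    (y : L) (hyH : y ∈ H) (hy : y ∈ s.ideal j.castSucc) (hy' : y ∉ s.ideal j.succ)
    (hf : ∀ u ∈ H, ∀ b ∈ H, b ∈ s.ideal j.succ → f ⁅u, b⁆ = 0)
    (hyj : ∀ z ∈ H, z ∈ s.ideal j.castSucc → f ⁅y, z⁆ = 0) :
    weightSpace s f M H ≤ weightSpace s f M (s.orthogonal f H j y hyH hy hy' hf) := by
  intro m hm i u hu hui hu0
  by_cases hall : ∀ r ∈ H, r ∈ s.ideal i → f ⁅u, r⁆ = 0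
  · exact hm i u hu.1 hui hall
  push Not at hall
  obtain ⟨r, hrH, hri, hr⟩ := hall
  have hry : f ⁅r, y⁆ ≠ 0 := fun h => hr (hu0 r ⟨hrH, h⟩ hri)
  have hyr : f ⁅y, r⁆ ≠ 0 := by rwa [← lie_skew, map_neg, neg_ne_zero]
  have hij : i ≤ j.castSucc := by
    by_contra hij
    exact hyr (hyj r hrH (s.antitone (not_le.1 hij).le hri))
  have hyi : y ∈ s.ideal i := s.antitone hij hy
  set b : K := f ⁅u, r⁆ / f ⁅y, r⁆ with hb
  have h1 : ⁅u - b • y, m⁆ = f (u - b • y) • m := by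
    refine hm i _ (sub_mem hu.1 (H.smul_mem b hyH)) (sub_mem hui ((s.ideal i).smul_mem b hyi)) ?_
    intro p hpH hpi
    set c : K := f ⁅p, y⁆ / f ⁅r, y⁆ with hc
    have hp' : f ⁅p - c • r, y⁆ = 0 := by
      rw [sub_lie, smul_lie, map_sub, map_smul, smul_eq_mul, hc, div_mul_cancel₀ _ hry, sub_self]
    have hyp : f ⁅y, p - c • r⁆ = 0 := by rw [← lie_skew, map_neg, hp', neg_zero]
    have hup : f ⁅u, p - c • r⁆ = 0 := hu0 _ ⟨sub_mem hpH (H.smul_mem c hrH), hp'⟩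
      (sub_mem hpi ((s.ideal i).smul_mem c hri))
    have hr' : f ⁅u - b • y, r⁆ = 0 := by
      rw [sub_lie, smul_lie, map_sub, map_smul, smul_eq_mul, hb, div_mul_cancel₀ _ hyr, sub_self]
    have e : ⁅u - b • y, p⁆ = ⁅u, p - c • r⁆ - b • ⁅y, p - c • r⁆ + c • ⁅u - b • y, r⁆ := by
      simp only [sub_lie, lie_sub, lie_smul, smul_lie, smul_sub]
      rw [smul_comm b c]
      abel
    rw [e, map_add, map_sub, map_smul, map_smul, hyp, hup, hr']
    simp
  have h2 : ⁅y, m⁆ = f y • m := hm j.castSucc y hyH hy hyj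
  rw [sub_lie, smul_lie, h2, map_sub, map_smul, sub_smul, smul_smul, smul_eq_mul] at h1
  exact sub_left_injective h1

/-- If `[H, S]` is contained in `S` and in the kernel of `f`, and `S` acts on `E` through `f`, then
`S` acts through `f` on the `H`-module generated by `E`. -/
theorem lie_eq_smul_of_mem_hull {f : Module.Dual K L} {H : LieSubalgebra K L} {E : Submodule K M}
    {S : Submodule K L} (hS : ∀ u ∈ H, ∀ x ∈ S, ⁅u, x⁆ ∈ S ∧ f ⁅u, x⁆ = 0)
    (hE : ∀ x ∈ S, ∀ m ∈ E, ⁅x, m⁆ = f x • m) {x : L} (hx : x ∈ S) {m : M} (hm : m ∈ hull H E) :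
    ⁅x, m⁆ = f x • m := by
  let N : Submodule K M :=
    { carrier := {m | ∀ x ∈ S, ⁅x, m⁆ = f x • m}
      add_mem' := fun {a b} ha hb x hx => by rw [lie_add, ha x hx, hb x hx, smul_add]
      zero_mem' := fun x _ => by simp
      smul_mem' := fun c a ha x hx => by rw [lie_smul, ha x hx, smul_comm] }
  -- N is H-stable because x u m = u x m - [u, x] m, and [u, x] acts on m as f([u, x]) = 0.
  have hN : hull H E ≤ N := by
    refine hull_le (fun m hm x hx => hE x hx m hm) fun u hu m hm x hx => ?_
    have h := hS u hu x hx
    have h2 := hm _ h.1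
    rw [h.2, zero_smul, lie_lie, hm x hx, lie_smul, sub_eq_zero] at h2
    exact h2.symm
  exact hN hm x hx

variable [CharZero K]

/-- The inductive step of `hull_inf_weightSpace`; `ih` is the claim for the orthogonal H' of y. With
Y = y - f(y) and B = `hull H' E`, Y lowers the degree in q over B and kills only B. A weight vector
is killed by Y, so it lies in B; a nonzero vector of least degree in a submodule is killed by Y as
well. -/
theorem hull_inf_weightSpace_of_orthogonal (s : LieFiltration K L k) (f : Module.Dual K L)
    (H : LieSubalgebra K L) (j : Fin k)
    (y : L) (hyH : y ∈ H) (hy : y ∈ s.ideal j.castSucc) (hy' : y ∉ s.ideal j.succ)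
    (hf : ∀ u ∈ H, ∀ b ∈ H, b ∈ s.ideal j.succ → f ⁅u, b⁆ = 0)
    {q : L} (hqH : q ∈ H) (hq : f ⁅q, y⁆ ≠ 0) {E : Submodule K M} (hE : E ≤ weightSpace s f M H)
    (ih : ∀ E ≤ weightSpace s f M (s.orthogonal f H j y hyH hy hy' hf),
      hull (s.orthogonal f H j y hyH hy hy' hf) E ⊓
          weightSpace s f M (s.orthogonal f H j y hyH hy hy' hf) ≤ E ∧
        ∀ N ≤ hull (s.orthogonal f H j y hyH hy hy' hf) E,
          (∀ x ∈ s.orthogonal f H j y hyH hy hy' hf, ∀ m ∈ N, ⁅x, m⁆ ∈ N) → N ≠ ⊥ → N ⊓ E ≠ ⊥) :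
    hull H E ⊓ weightSpace s f M H ≤ E ∧
      ∀ N ≤ hull H E, (∀ x ∈ H, ∀ m ∈ N, ⁅x, m⁆ ∈ N) → N ≠ ⊥ → N ⊓ E ≠ ⊥ := by
  have hyj : ∀ z ∈ H, z ∈ s.ideal j.castSucc → f ⁅y, z⁆ = 0 := by
    intro z hzH hz
    obtain ⟨c, hc⟩ := s.exists_sub_smul_mem j hy hy' hz
    have := hf y hyH _ (sub_mem hzH (H.smul_mem c hyH)) hc
    rwa [lie_sub, lie_smul, lie_self, smul_zero, sub_zero] at this
  set H' := s.orthogonal f H j y hyH hy hy' hf with hH'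
  have hle : weightSpace s f M H ≤ weightSpace s f M H' :=
    s.weightSpace_le_of_orthogonal f H j y hyH hy hy' hf hyj
  have hH'H : H' ≤ H := fun u hu => hu.1
  have hspan : ∀ u ∈ H, ∃ c : K, u - c • q ∈ H' := fun u hu =>
    ⟨f ⁅u, y⁆ / f ⁅q, y⁆, sub_mem hu (H.smul_mem _ hqH), by
      rw [sub_lie, smul_lie, map_sub, map_smul, smul_eq_mul, div_mul_cancel₀ _ hq, sub_self]⟩
  have hscal : ∀ b ∈ H, b ∈ s.ideal j.succ → ∀ m ∈ hull H E, ⁅b, m⁆ = f b • m := by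
    intro b hbH hb m hm
    refine lie_eq_smul_of_mem_hull (S := H.toSubmodule ⊓ (s.ideal j.succ).toSubmodule)
      (fun u hu x hx => ⟨⟨H.lie_mem hu hx.1, lie_mem_right K L _ u x hx.2⟩,
        hf u hu x hx.1 hx.2⟩) (fun x hx m hm => hE hm j.succ x hx.1 hx.2 ?_) ⟨hbH, hb⟩ hm
    intro z hz _
    rw [← lie_skew, map_neg, hf z hz x hx.1 hx.2, neg_zero]
  -- Here only the smaller hull is allowed: f([u, y]) = 0 is known for u in H', not for u = q.
  have hyB : ∀ m ∈ hull H' E, ⁅y, m⁆ = f y • m := by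
    intro m hm
    refine lie_eq_smul_of_mem_hull (S := H'.toSubmodule ⊓ (s.ideal j.castSucc).toSubmodule)
      (fun u hu x hx => ⟨⟨H'.lie_mem hu hx.1, lie_mem_right K L _ u x hx.2⟩, ?_⟩)
      (fun x hx m hm => hE hm j.castSucc x hx.1.1 hx.2 ?_) ⟨⟨hyH, by simp⟩, hy⟩ hm
    · obtain ⟨c, hc⟩ := s.exists_sub_smul_mem j hy hy' hx.2
      have := hf u hu.1 _ (sub_mem hx.1.1 (H.smul_mem c hyH)) hc
      rwa [lie_sub, lie_smul, map_sub, map_smul, hu.2, smul_zero, sub_zero] at this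
    · intro z hzH hz
      obtain ⟨c, hc⟩ := s.exists_sub_smul_mem j hy hy' hz
      have := hf x hx.1.1 _ (sub_mem hzH (H.smul_mem c hyH)) hc
      rwa [lie_sub, lie_smul, map_sub, map_smul, hx.1.2, smul_zero, sub_zero] at this
  obtain ⟨c, b, hbH, hb, hqy⟩ := s.exists_lie_eq hyH hy hy' hqH
  have hqy' : f ⁅q, y⁆ = c * f y + f b := by rw [hqy, map_add, map_smul, smul_eq_mul]
  let Y : Module.End K M := LieModule.toEnd K L M y - f y • LinearMap.id
  have hYdef : ∀ m, Y m = ⁅y, m⁆ - f y • m := fun m => rfl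
  have hY : ∀ m ∈ hull H' E, Y m = 0 := fun m hm => by rw [hYdef, hyB m hm, sub_self]
  -- As [q, y] = c y + b and b acts as f(b), the commutator of Y and q is -c Y - (c f(y) + f(b)),
  -- and the constant is f([q, y]).
  have hYq : ∀ m ∈ hull H E, Y ⁅q, m⁆ = ⁅q, Y m⁆ - c • Y m - f ⁅q, y⁆ • m := by
    intro m hm
    have h : ⁅⁅q, y⁆, m⁆ = c • ⁅y, m⁆ + f b • m := by
      rw [hqy, add_lie, smul_lie, hscal b hbH hb m hm]
    rw [lie_lie] at h
    rw [hYdef, hYdef, lie_sub, lie_smul, smul_sub, smul_smul, hqy', add_smul,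
      eq_sub_of_add_eq' (sub_eq_iff_eq_add.1 h).symm]
    abel
  have hP : ∀ n, tower q (hull H' E) n ≤ hull H E := by
    intro n
    induction n with
    | zero => exact bot_le
    | succ n ihn =>
      refine sup_le (sup_le (hull_le (le_hull H E)
        fun x hx m hm => lie_mem_hull _ _ (hH'H hx) hm) ihn) ?_
      rintro _ ⟨m, hm, rfl⟩
      exact lie_mem_hull _ _ hqH (ihn hm)
  have hdesc : ∀ n, ∀ w ∈ tower q (hull H' E) (n + 2), Y w = 0 → w ∈ tower q (hull H' E) (n + 1) :=
    fun n w hw hw0 => mem_tower_of_lowering_eq_zero hq hY hP hYq hw hw0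
  obtain ⟨ih1, ih2⟩ := ih E (hE.trans hle)
  constructor
  · rintro e ⟨he, he'⟩
    have hYe : Y e = 0 := by rw [hYdef, he' j.castSucc y hyH hy hyj, sub_self]
    obtain ⟨n, hn⟩ := exists_mem_tower hH'H hqH hspan he
    have hn' : e ∈ tower q (hull H' E) (n + 1) := tower_le_succ n hn
    clear hn
    have he1 : e ∈ hull H' E := by
      induction n with
      | zero => rwa [tower_one] at hn'
      | succ n ihn => exact ihn (hdesc n e hn' hYe)
    exact ih1 ⟨he1, hle he'⟩
  · intro N hN hNH hN0
    have hex : ∃ n, ∃ w ∈ N, w ≠ 0 ∧ w ∈ tower q (hull H' E) n := by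
      obtain ⟨w, hw, hw0⟩ := N.ne_bot_iff.1 hN0
      obtain ⟨n, hn⟩ := exists_mem_tower hH'H hqH hspan (hN hw)
      exact ⟨n, w, hw, hw0, hn⟩
    classical
    obtain ⟨n, ⟨w, hw, hw0, hwn⟩, hmin⟩ : ∃ n, (∃ w ∈ N, w ≠ 0 ∧ w ∈ tower q (hull H' E) n) ∧
        ∀ m < n, ¬ ∃ w ∈ N, w ≠ 0 ∧ w ∈ tower q (hull H' E) m :=
      ⟨Nat.find hex, Nat.find_spec hex, fun m hm => Nat.find_min hex hm⟩
    have hwB : w ∈ hull H' E := by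
      match n, hwn, hmin with
      | 0, hwn, _ => exact absurd ((Submodule.mem_bot K).1 hwn) hw0
      | 1, hwn, _ => rwa [tower_one] at hwn
      | n + 2, hwn, hmin =>
        exfalso
        -- Y w lies in N and has smaller degree, so minimality gives Y w = 0; but then w itself has
        -- smaller degree.
        have hYw : Y w = 0 := by
          by_contra h
          exact hmin (n + 1) (by omega) ⟨Y w, sub_mem (hNH y hyH w hw) (N.smul_mem _ hw), h,
            (lowering_tower hY hP hYq (n + 1) w hwn).1⟩
        exact hmin (n + 1) (by omega) ⟨w, hw, hw0, hdesc n w hwn hYw⟩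
    have h := ih2 (N ⊓ hull H' E) inf_le_right
      (fun x hx m hm => ⟨hNH x (hH'H hx) m hm.1, lie_mem_hull _ _ hx hm.2⟩)
      ((Submodule.ne_bot_iff _).2 ⟨w, ⟨hw, hwB⟩, hw0⟩)
    intro h0
    exact h (eq_bot_iff.2 (le_trans (inf_le_inf_right E inf_le_left) h0.le))

/-- Let `E` be a space of vectors on which the stabilizers of `f` act through `f`. In the
`H`-module generated by `E` there are no other such vectors, and every nonzero submodule
meets `E`. -/
theorem hull_inf_weightSpace (s : LieFiltration K L k) (f : Module.Dual K L)
    (H : LieSubalgebra K L) {E : Submodule K M} (hE : E ≤ weightSpace s f M H) :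
    hull H E ⊓ weightSpace s f M H ≤ E ∧
      ∀ N ≤ hull H E, (∀ x ∈ H, ∀ m ∈ N, ⁅x, m⁆ ∈ N) → N ≠ ⊥ → N ⊓ E ≠ ⊥ := by
  have := s.finite_of_filtration
  induction hn : Module.finrank K H.toSubmodule using Nat.strong_induction_on
    generalizing H E with
  | _ n ih =>
  by_cases h0 : ∀ x ∈ H, ∀ y ∈ H, f ⁅x, y⁆ = 0
  · have hHE : hull H E ≤ E := hull_le le_rfl fun x hx m hm => by
      rw [hE hm 0 x hx (by rw [s.ideal_zero]; trivial) fun y hy _ => h0 x hx y hy]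
      exact E.smul_mem _ hm
    refine ⟨inf_le_left.trans hHE, fun N hN _ hN0 => ?_⟩
    rwa [inf_eq_left.2 (hN.trans hHE)]
  -- The last j with f([H, H ∩ L_j]) ≠ 0 exists because L_k = 0 and f([H, H]) ≠ 0.
  have hj : ∃ j : Fin k, (∀ u ∈ H, ∀ b ∈ H, b ∈ s.ideal j.succ → f ⁅u, b⁆ = 0) ∧
      ∃ q ∈ H, ∃ y ∈ H, y ∈ s.ideal j.castSucc ∧ f ⁅q, y⁆ ≠ 0 := by
    by_contra hcon
    have hall : ∀ i, ∀ u ∈ H, ∀ b ∈ H, b ∈ s.ideal i → f ⁅u, b⁆ = 0 := by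
      intro i
      induction i using Fin.reverseInduction with
      | last =>
        intro u _ b _ hb
        rw [s.ideal_last, LieSubmodule.mem_bot] at hb
        rw [hb, lie_zero, map_zero]
      | cast i ihi =>
        intro u hu b hb hbi
        by_contra hne
        exact hcon ⟨i, ihi, u, hu, b, hb, hbi, hne⟩
    exact h0 fun x hx y hy => hall 0 x hx y hy (by rw [s.ideal_zero]; trivial)
  obtain ⟨j, hf, q, hqH, y, hyH, hy, hq⟩ := hj
  have hy' : y ∉ s.ideal j.succ := fun h => hq (hf q hqH y hyH h)
  refine s.hull_inf_weightSpace_of_orthogonal f H j y hyH hy hy' hf hqH hq hE fun E' hE' => ?_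
  refine ih _ ?_ _ hE' rfl
  rw [← hn]
  refine Submodule.finrank_lt_finrank_of_lt (lt_of_le_of_ne (fun u hu => hu.1) fun h => hq ?_)
  have hq' : q ∈ (s.orthogonal f H j y hyH hy hy' hf).toSubmodule := by
    rw [h]; exact hqH
  exact hq'.2

end LieFiltration

end

/-! ### Modules induced by a character -/

noncomputable section

section InducedModules

attribute [local instance 100] LieRing.ofAssociativeRing

variable {K : Type*} [Field K] {L : Type*} [LieRing L] [LieAlgebra K L]

/-- By the universal property, the map U(L) → S extending L → S, followed by the inclusion of S, is
the identity. -/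
theorem UniversalEnvelopingAlgebra.mem_of_forall_ι_mem
    {S : Subalgebra K (UniversalEnvelopingAlgebra K L)}
    (h : ∀ x : L, UniversalEnvelopingAlgebra.ι K x ∈ S) (u : UniversalEnvelopingAlgebra K L) :
    u ∈ S := by
  let g : L →ₗ⁅K⁆ S :=
    { toFun := fun x => ⟨UniversalEnvelopingAlgebra.ι K x, h x⟩
      map_add' := fun x y => by ext; exact map_add (UniversalEnvelopingAlgebra.ι K) x y
      map_smul' := fun c x => by ext; exact map_smul (UniversalEnvelopingAlgebra.ι K) c x
      map_lie' := fun {x y} => by ext; exact LieHom.map_lie (UniversalEnvelopingAlgebra.ι K) x y }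
  have hg : S.val.comp (UniversalEnvelopingAlgebra.lift K g) = AlgHom.id K _ := by
    apply UniversalEnvelopingAlgebra.hom_ext
    ext x : 1
    simp only [LieHom.comp_apply, AlgHom.toLieHom_apply, AlgHom.comp_apply,
      UniversalEnvelopingAlgebra.lift_ι_apply]
    rfl
  have := DFunLike.congr_fun hg u
  rw [AlgHom.id_apply] at this
  rw [← this]
  exact (UniversalEnvelopingAlgebra.lift K g u).2

namespace Ind

variable (p : LieSubalgebra K L) (ρ : p →ₗ⁅K⁆ Module.End K K)

/-- The generator `1 ⊗ 1` of a module induced by a character. -/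
def gen : Ind p ρ := mk p ρ (1 ⊗ₜ[K] 1)

theorem smul_gen (u : UniversalEnvelopingAlgebra K L) : u • gen p ρ = mk p ρ (u ⊗ₜ[K] 1) := by
  rw [gen, ← map_smul, TensorProduct.smul_tmul', smul_eq_mul, mul_one]

theorem lie_gen (x : p) : ⁅(x : L), gen p ρ⁆ = ρ x 1 • gen p ρ := by
  have h : mk p ρ ((1 * envMap p.incl (UniversalEnvelopingAlgebra.ι K x)) ⊗ₜ[K] (1 : K) -
      1 ⊗ₜ[K] (UniversalEnvelopingAlgebra.lift K ρ (UniversalEnvelopingAlgebra.ι K x) 1)) = 0 :=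
    (Submodule.Quotient.mk_eq_zero _).2 (Submodule.subset_span ⟨_, _, _, rfl⟩)
  rw [map_sub, sub_eq_zero, one_mul, envMap_ι, UniversalEnvelopingAlgebra.lift_ι_apply] at h
  rw [lie_def, smul_gen]
  refine h.trans ?_
  have e : (1 : UniversalEnvelopingAlgebra K L) ⊗ₜ[K] (ρ x 1) =
      algebraMap K (UniversalEnvelopingAlgebra K L) (ρ x 1) • ((1 : UniversalEnvelopingAlgebra K L)
        ⊗ₜ[K] (1 : K)) := by
    rw [algebraMap_smul, ← TensorProduct.tmul_smul, smul_eq_mul, mul_one]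
  rw [e, map_smul, algebraMap_smul]
  rfl

theorem exists_smul_gen (m : Ind p ρ) : ∃ u : UniversalEnvelopingAlgebra K L, u • gen p ρ = m := by
  obtain ⟨z, rfl⟩ := Submodule.Quotient.mk_surjective _ m
  obtain ⟨u, rfl⟩ := (TensorProduct.rid K _).symm.surjective z
  exact ⟨u, smul_gen p ρ u⟩

variable {p ρ}

/-- A subspace invariant under a subalgebra is invariant under its enveloping algebra. -/
theorem envMap_smul_mem {L' : Type*} [LieRing L'] [LieAlgebra K L'] (φ : L' →ₗ⁅K⁆ L)
    {N : Submodule K (Ind p ρ)} (hN : ∀ x : L', ∀ m ∈ N, ⁅φ x, m⁆ ∈ N)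
    (u : UniversalEnvelopingAlgebra K L') {m : Ind p ρ} (hm : m ∈ N) : envMap φ u • m ∈ N := by
  let S : Subalgebra K (UniversalEnvelopingAlgebra K L') :=
    { carrier := {u | ∀ m ∈ N, envMap φ u • m ∈ N}
      mul_mem' := fun {a b} ha hb m hm => by
        rw [map_mul, mul_smul]; exact ha _ (hb _ hm)
      add_mem' := fun {a b} ha hb m hm => by
        rw [map_add, add_smul]; exact add_mem (ha _ hm) (hb _ hm)
      algebraMap_mem' := fun c m hm => by
        rw [AlgHom.commutes, algebraMap_smul]; exact N.smul_mem c hm }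
  refine UniversalEnvelopingAlgebra.mem_of_forall_ι_mem (S := S) (fun x m hm => ?_) u m hm
  rw [envMap_ι]
  exact hN x m hm

theorem eq_top_of_gen_mem {N : Submodule K (Ind p ρ)} (hg : gen p ρ ∈ N)
    (hN : ∀ x : L, ∀ m ∈ N, ⁅x, m⁆ ∈ N) : N = ⊤ := by
  rw [eq_top_iff]
  rintro m -
  obtain ⟨u, rfl⟩ := exists_smul_gen p ρ m
  have := envMap_smul_mem (LieHom.id : L →ₗ⁅K⁆ L) hN u hg
  rwa [envMap_id] at this

/-- The universal property of a module induced by a character. -/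
theorem exists_lift {V : Type*} [AddCommGroup V] [Module K V] (σ : L →ₗ[K] Module.End K V)
    (hσ : ∀ x y v, σ ⁅x, y⁆ v = σ x (σ y v) - σ y (σ x v)) (v : V)
    (hv : ∀ x : p, σ x v = ρ x 1 • v) :
    ∃ φ : Ind p ρ →ₗ[K] V, φ (gen p ρ) = v ∧ ∀ x m, φ ⁅x, m⁆ = σ x (φ m) := by
  let σ' : L →ₗ⁅K⁆ Module.End K V :=
    { σ with
      map_lie' := fun {x y} => by
        ext w
        exact hσ x y w }
  have hσ' : ∀ x, σ' x = σ x := fun x => rfl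
  let A := UniversalEnvelopingAlgebra.lift K σ'
  -- The elements of U(p) acting on v through the character form a subalgebra, so the condition need
  -- only be checked on p.
  let S : Subalgebra K (UniversalEnvelopingAlgebra K p) :=
    { carrier := {a | A (envMap p.incl a) v = UniversalEnvelopingAlgebra.lift K ρ a 1 • v}
      mul_mem' := fun {a b} ha hb => by
        have hmul : ∀ (T : Module.End K K) (c : K), T c = c * T 1 := fun T c => by
          rw [← smul_eq_mul, ← map_smul, smul_eq_mul, mul_one]
        simp only [Set.mem_ofPred_eq, map_mul, Module.End.mul_apply] at ha hb ⊢
        rw [hb, map_smul, ha, smul_smul, hmul _ (UniversalEnvelopingAlgebra.lift K ρ b 1)]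
      add_mem' := fun {a b} ha hb => by
        simp only [Set.mem_ofPred_eq, map_add, LinearMap.add_apply, add_smul] at ha hb ⊢
        rw [ha, hb]
      algebraMap_mem' := fun c => by
        simp [AlgHom.commutes, Module.algebraMap_end_apply] }
  have hS : ∀ a, A (envMap p.incl a) v = UniversalEnvelopingAlgebra.lift K ρ a 1 • v := by
    refine fun a => UniversalEnvelopingAlgebra.mem_of_forall_ι_mem (S := S) (fun x => ?_) a
    change A (envMap p.incl (UniversalEnvelopingAlgebra.ι K x)) v = _
    rw [envMap_ι, UniversalEnvelopingAlgebra.lift_ι_apply, UniversalEnvelopingAlgebra.lift_ι_apply]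
    exact hv x
  let φ₀ : UniversalEnvelopingAlgebra K L ⊗[K] K →ₗ[K] V :=
    ((LinearMap.applyₗ v).comp A.toLinearMap).comp (TensorProduct.rid K _).toLinearMap
  have hφ₀ : ∀ u c, φ₀ (u ⊗ₜ[K] c) = c • A u v := fun u c => by
    simp [φ₀]
  have hsmul : ∀ u z, φ₀ (u • z) = A u (φ₀ z) := by
    intro u z
    induction z with
    | zero => simp
    | add a b ha hb => simp only [smul_add, map_add, ha, hb]
    | tmul w c =>
      rw [TensorProduct.smul_tmul', smul_eq_mul, hφ₀, hφ₀, map_mul, Module.End.mul_apply, map_smul]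
  have hker : ∀ z ∈ indRel p ρ, φ₀ z = 0 := by
    intro z hz
    induction hz using Submodule.span_induction with
    | zero => simp
    | add a b _ _ ha hb => rw [map_add, ha, hb, add_zero]
    | smul u a _ ha => rw [hsmul, ha, map_zero]
    | mem z hz =>
      obtain ⟨u, a, w, rfl⟩ := hz
      have hw : UniversalEnvelopingAlgebra.lift K ρ a w =
          w * UniversalEnvelopingAlgebra.lift K ρ a 1 := by
        rw [← smul_eq_mul, ← map_smul, smul_eq_mul, mul_one]
      rw [map_sub, hφ₀, hφ₀, map_mul, Module.End.mul_apply, hS, map_smul, hw, mul_smul, sub_self]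
  refine ⟨Submodule.liftQ ((indRel p ρ).restrictScalars K) φ₀ hker, ?_, ?_⟩
  · change φ₀ (1 ⊗ₜ[K] 1) = v
    rw [hφ₀, map_one, one_smul, Module.End.one_apply]
  · intro x m
    obtain ⟨z, rfl⟩ := Submodule.Quotient.mk_surjective _ m
    change φ₀ (UniversalEnvelopingAlgebra.ι K x • z) = σ x (φ₀ z)
    rw [hsmul, UniversalEnvelopingAlgebra.lift_ι_apply, hσ']

end Ind

end InducedModules

namespace LieFiltration

universe uK uL

variable {K : Type uK} [Field K] {L : Type uL} [LieRing L] [LieAlgebra K L] {k : ℕ}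

/-! ### Extending a representation from L_{i+1} to L_i -/

section Extension

variable {V : Type*} [AddCommGroup V] [Module K V]

/-- `ρ` represents the ideal `I` in `V`; no condition is put on the values of `ρ` outside `I`. -/
def RepresentsOn (I : LieIdeal K L) (ρ : L →ₗ[K] Module.End K V) : Prop :=
  ∀ x ∈ I, ∀ y ∈ I, ∀ v, ρ ⁅x, y⁆ v = ρ x (ρ y v) - ρ y (ρ x v)

/-- The map which agrees with `ρ` on the kernel of `l` and takes the value `T` at `x`, where
`l x = 1`. -/
def extendBy (ρ : L →ₗ[K] Module.End K V) (l : Module.Dual K L) (x : L) (T : Module.End K V) :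
    L →ₗ[K] Module.End K V :=
  ρ.comp (LinearMap.id - l.smulRight x) + l.smulRight T

theorem extendBy_apply (ρ : L →ₗ[K] Module.End K V) (l : Module.Dual K L) (x : L)
    (T : Module.End K V) (u : L) (v : V) :
    extendBy ρ l x T u v = ρ (u - l u • x) v + l u • T v := rfl

/-- Since L_i = L_{i+1} + K x, the only relations are those inside L_{i+1} and those between x and
L_{i+1}. -/
theorem representsOn_extendBy (s : LieFiltration K L k) (i : Fin k) {x : L}
    (hx : x ∈ s.ideal i.castSucc) (hx' : x ∉ s.ideal i.succ) {l : Module.Dual K L} (hl : l x = 1)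
    (hl' : ∀ y ∈ s.ideal i.succ, l y = 0) {ρ : L →ₗ[K] Module.End K V}
    (hρ : RepresentsOn (s.ideal i.succ) ρ) {T : Module.End K V}
    (hT : ∀ y ∈ s.ideal i.succ, ∀ v, ρ ⁅x, y⁆ v = T (ρ y v) - ρ y (T v)) :
    RepresentsOn (s.ideal i.castSucc) (extendBy ρ l x T) := by
  intro u hu w hw v
  have hu1 := s.sub_smul_mem_of_dual i hx hx' hl hl' hu
  have hw1 := s.sub_smul_mem_of_dual i hx hx' hl hl' hw
  have h0 : l ⁅u, w⁆ = 0 := hl' _ (s.lie_mem_ideal_succ i hu hw)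
  simp only [extendBy_apply, h0, zero_smul, sub_zero, add_zero]
  have e : ⁅u, w⁆ = ⁅u - l u • x, w - l w • x⁆ + l u • ⁅x, w - l w • x⁆ -
      l w • ⁅x, u - l u • x⁆ := by
    simp only [lie_sub, sub_lie, lie_smul, smul_lie, lie_self, smul_zero, sub_zero]
    rw [← lie_skew x u]
    simp only [smul_neg]
    abel
  rw [e, map_sub, map_add, map_smul, map_smul]
  simp only [LinearMap.sub_apply, LinearMap.add_apply, LinearMap.smul_apply, hρ _ hu1 _ hw1,
    hT _ hu1, hT _ hw1, map_add, map_smul, smul_sub, smul_add]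
  rw [smul_comm (l u) (l w) (T (T v))]
  abel

end Extension

section PolynomialExtension

variable {V : Type*} [AddCommGroup V] [Module K V]

/-- Multiplication by the variable in `V[t]`. -/
def shift (V : Type*) [AddCommGroup V] [Module K V] : Module.End K (ℕ →₀ V) :=
  Finsupp.lmapDomain V K Nat.succ

theorem shift_single (n : ℕ) (v : V) :
    shift (K := K) V (Finsupp.single n v) = Finsupp.single (n + 1) v :=
  Finsupp.mapDomain_single

/-- The operators `v ↦ y (t^n v)`, where `t` acts as the element `x`. -/
def polyRepAux (x : L) (ρ : L →ₗ[K] Module.End K V) : ℕ → L →ₗ[K] V →ₗ[K] (ℕ →₀ V)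
  | 0 => (LinearMap.llcomp K V V (ℕ →₀ V) (Finsupp.lsingle 0)).comp ρ
  -- The rule y t = t y - [x, y], forced by x acting as t.
  | n + 1 => (LinearMap.llcomp K V (ℕ →₀ V) (ℕ →₀ V) (shift V)).comp (polyRepAux x ρ n) -
      (polyRepAux x ρ n).comp (LieAlgebra.ad K L x)

/-- The module `V[t]` induced by `V`, in which `x` acts as multiplication by `t`. -/
def polyRep (x : L) (ρ : L →ₗ[K] Module.End K V) : L →ₗ[K] Module.End K (ℕ →₀ V) where
  toFun y := Finsupp.lsum K fun n => polyRepAux x ρ n y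
  map_add' y z := by ext; simp
  map_smul' c y := by ext; simp

theorem polyRep_single_zero (x : L) (ρ : L →ₗ[K] Module.End K V) (y : L) (v : V) :
    polyRep x ρ y (Finsupp.single 0 v) = Finsupp.single 0 (ρ y v) := by
  simp [polyRep, polyRepAux]

theorem polyRep_shift (x : L) (ρ : L →ₗ[K] Module.End K V) (y : L) (w : ℕ →₀ V) :
    polyRep x ρ y (shift (K := K) V w) =
      shift (K := K) V (polyRep x ρ y w) - polyRep x ρ ⁅x, y⁆ w := by
  induction w using Finsupp.induction_linear with
  | zero => simp
  | add a b ha hb => simp only [map_add, ha, hb]; abel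
  | single n v =>
    rw [shift_single]
    simp [polyRep, polyRepAux]

/-- Induction on the degree in t. Moving y and z past t produces [x, y] and [x, z], so all pairs in
I are treated at once. -/
theorem representsOn_polyRep {I : LieIdeal K L} (x : L) {ρ : L →ₗ[K] Module.End K V}
    (hρ : RepresentsOn I ρ) : RepresentsOn I (polyRep x ρ) := by
  intro y hy z hz w
  induction w using Finsupp.induction_linear with
  | zero => simp
  | add a b ha hb => simp only [map_add, ha, hb]; abel
  | single n v =>
    induction n generalizing y z with
    | zero => simp only [polyRep_single_zero, hρ y hy z hz, Finsupp.single_sub]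
    | succ n ih =>
      have hxy : ⁅x, y⁆ ∈ I := lie_mem_right K L I x y hy
      have hxz : ⁅x, z⁆ ∈ I := lie_mem_right K L I x z hz
      rw [← shift_single (K := K)]
      simp only [polyRep_shift, map_sub, leibniz_lie x y z, map_add, LinearMap.add_apply]
      rw [ih y hy z hz, ih _ hxy z hz, ih y hy _ hxz, map_sub]
      abel

end PolynomialExtension

/-! ### The generator of M(f) is nonzero -/

section Nonvanishing

variable (s : LieFiltration K L k) (f : Module.Dual K L)

/-- In the filtration induced on L_i, all terms of index j ≤ i equal L_i, so only the stabilizers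
with j ≥ i contribute. -/
theorem mem_of_mem_vergne_restrict (i : Fin (k + 1)) {S : Submodule K L}
    (hS : ∀ j, i ≤ j → s.stabilizer f j ≤ S) {x : s.ideal i}
    (hx : x ∈ (s.restrict (s.ideal i)).vergne (res f (s.ideal i))) : (x : L) ∈ S := by
  change x ∈ ⨆ j, (s.restrict (s.ideal i)).stabilizer (res f (s.ideal i)) j at hx
  induction hx using Submodule.iSup_induction' with
  | zero => exact zero_mem _
  | add a b _ _ ha hb => exact add_mem ha hb
  | mem j x hx =>
    rcases le_total i j with h | h
    · exact hS j h ⟨hx.1, fun y hy => hx.2 ⟨y, s.antitone h hy⟩ hy⟩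
    · exact hS i le_rfl ⟨x.2, fun y hy => hx.2 ⟨y, hy⟩ (s.antitone h hy)⟩

theorem mem_vergne_restrict_of_mem_stabilizer {i j : Fin (k + 1)} (hij : i ≤ j) {x : L}
    (hx : x ∈ s.stabilizer f j) : (⟨x, s.antitone hij hx.1⟩ : s.ideal i) ∈
      (s.restrict (s.ideal i)).vergne (res f (s.ideal i)) :=
  Submodule.mem_iSup_of_mem (p := (s.restrict (s.ideal i)).stabilizer (res f (s.ideal i))) j
    ⟨hx.1, fun y hy => hx.2 y hy⟩

theorem character_apply (x : s.vergne f) : s.character f x 1 = f x := by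
  simp [character]

theorem lie_gen_of_mem_vergne {x : L} (hx : x ∈ s.vergne f) :
    ⁅x, Ind.gen (s.vergne f) (s.character f)⁆ = f x • Ind.gen (s.vergne f) (s.character f) := by
  have h := Ind.lie_gen (s.vergne f) (s.character f) ⟨x, hx⟩
  rwa [character_apply] at h

variable {s f}

/-- If `x` lies in the stabilizer of `f` in `L_i`, then the derivation `ad x` of `L_{i+1}` extends to the module induced by the Vergne polarization in `L_{i+1}`. -/
theorem exists_derivation (i : Fin k) {x : L} (hx : x ∈ s.stabilizer f i.castSucc) :
    ∃ T : Module.End K ((s.restrict (s.ideal i.succ)).M (res f (s.ideal i.succ))),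
      T (Ind.gen _ _) = f x • Ind.gen _ _ ∧
      ∀ (y : s.ideal i.succ) m, ⁅(⟨⁅x, y⁆, lie_mem_right K L _ x y y.2⟩ : s.ideal i.succ), m⁆ =
        T ⁅y, m⁆ - ⁅y, T m⁆ := by
  set N := (s.restrict (s.ideal i.succ)).M (res f (s.ideal i.succ))
  let g : N := Ind.gen _ _
  let D : s.ideal i.succ →ₗ[K] s.ideal i.succ :=
    { toFun := fun y => ⟨⁅x, (y : L)⁆, lie_mem_right K L _ x y y.2⟩
      map_add' := fun a b => by ext; simp
      map_smul' := fun c a => by ext; simp }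
  have hD : ∀ y z, D ⁅y, z⁆ = ⁅D y, z⁆ + ⁅y, D z⁆ := fun y z => by
    ext
    exact leibniz_lie x (y : L) (z : L)
  have hgen : ∀ j (hj : i.succ ≤ j) y (hy : y ∈ s.stabilizer f j),
      ⁅(⟨y, s.antitone hj hy.1⟩ : s.ideal i.succ), g⁆ = f y • g := fun j hj y hy =>
    (s.restrict (s.ideal i.succ)).lie_gen_of_mem_vergne (res f (s.ideal i.succ))
      (s.mem_vergne_restrict_of_mem_stabilizer f hj hy)
  -- With (m, n) read as m + ε n over the dual numbers, y acts as y + ε [x, y]. The ε-part of a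
  -- homomorphism N → N × N lifting the identity is the required T.
  let σ : s.ideal i.succ →ₗ[K] Module.End K (N × N) :=
    { toFun := fun y =>
        ((LieModule.toEnd K (s.ideal i.succ) N y).comp (LinearMap.fst K N N)).prod
          ((LieModule.toEnd K (s.ideal i.succ) N y).comp (LinearMap.snd K N N) +
            (LieModule.toEnd K (s.ideal i.succ) N (D y)).comp (LinearMap.fst K N N))
      map_add' := fun a b => by
        apply LinearMap.ext
        rintro ⟨m, n⟩
        change (⁅a + b, m⁆, ⁅a + b, n⁆ + ⁅D (a + b), m⁆) =
          (⁅a, m⁆ + ⁅b, m⁆, ⁅a, n⁆ + ⁅D a, m⁆ + (⁅b, n⁆ + ⁅D b, m⁆))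
        rw [map_add, add_lie, add_lie, add_lie, add_add_add_comm]
      map_smul' := fun c a => by
        apply LinearMap.ext
        rintro ⟨m, n⟩
        simp }
  have hσ : ∀ y m n, σ y (m, n) = (⁅y, m⁆, ⁅y, n⁆ + ⁅D y, m⁆) := fun y m n => rfl
  obtain ⟨φ, hφg, hφ⟩ := Ind.exists_lift (p := (s.restrict (s.ideal i.succ)).vergne _)
    (ρ := (s.restrict (s.ideal i.succ)).character (res f (s.ideal i.succ))) σ (by
      rintro y z ⟨m, n⟩
      simp only [hσ, hD, Prod.mk_sub_mk, lie_lie, add_lie, lie_add]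
      congr 1
      abel) (g, f x • g) (by
      rintro ⟨y, hy⟩
      let S : Submodule K L :=
        { carrier := {y | ∃ hy : y ∈ s.ideal i.succ, σ ⟨y, hy⟩ (g, f x • g) = f y • (g, f x • g)}
          add_mem' := fun {a b} ⟨ha, ha'⟩ ⟨hb, hb'⟩ => ⟨add_mem ha hb, by
            have : (⟨a + b, add_mem ha hb⟩ : s.ideal i.succ) = ⟨a, ha⟩ + ⟨b, hb⟩ := rfl
            rw [this, map_add, LinearMap.add_apply, ha', hb', map_add, add_smul]⟩
          zero_mem' := ⟨zero_mem _, by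
            have : (⟨0, zero_mem _⟩ : s.ideal i.succ) = 0 := rfl
            rw [this, map_zero, map_zero, zero_smul, LinearMap.zero_apply]⟩
          smul_mem' := fun c a ⟨ha, ha'⟩ => ⟨(s.ideal i.succ).smul_mem c ha, by
            have : (⟨c • a, (s.ideal i.succ).smul_mem c ha⟩ : s.ideal i.succ) = c • ⟨a, ha⟩ := rfl
            rw [this, map_smul, LinearMap.smul_apply, ha', map_smul, smul_assoc]⟩ }
      -- For z in a stabilizer, [x, z] is in the same stabilizer and f([x, z]) = 0, so [x, z] kills
      -- g and (g, f(x) g) satisfies the relations of the generator.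
      have hyS : (y : L) ∈ S := by
        refine s.mem_of_mem_vergne_restrict f i.succ (fun j hj z hz => ?_) hy
        refine ⟨s.antitone hj hz.1, ?_⟩
        have h1 := hgen j hj z hz
        have h2 := hgen j hj _
          (s.lie_mem_stabilizer f (i.castSucc_lt_succ.le.trans hj) hx hz)
        rw [hx.2 z (s.antitone (i.castSucc_lt_succ.le.trans hj) hz.1), zero_smul] at h2
        rw [hσ, lie_smul, h1, smul_comm]
        refine Prod.ext rfl ?_
        change _ + _ = _
        rw [show D ⟨z, s.antitone hj hz.1⟩ = ⟨⁅x, z⁆, _⟩ from rfl, h2, add_zero]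
        rfl
      obtain ⟨hy', h⟩ := hyS
      refine Eq.trans h ?_
      rw [character_apply]
      rfl)
  have hfst : ∀ m, (φ m).1 = m := by
    have : LinearMap.eqLocus ((LinearMap.fst K N N).comp φ) LinearMap.id = ⊤ := by
      refine Ind.eq_top_of_gen_mem ?_ ?_
      · change (φ (Ind.gen _ _)).1 = _
        rw [hφg]
        rfl
      · intro y m hm
        change (φ m).1 = m at hm
        change (φ ⁅y, m⁆).1 = ⁅y, m⁆
        rw [hφ]
        change ⁅y, (φ m).1⁆ = _
        rw [hm]
    intro m
    have hm : m ∈ LinearMap.eqLocus ((LinearMap.fst K N N).comp φ) LinearMap.id := by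
      rw [this]; trivial
    exact hm
  refine ⟨(LinearMap.snd K N N).comp φ, ?_, ?_⟩
  · change (φ (Ind.gen _ _)).2 = _
    rw [hφg]
  · intro y m
    change _ = (φ ⁅y, m⁆).2 - ⁅y, (φ m).2⁆
    rw [hφ]
    change _ = ⁅y, (φ m).2⁆ + ⁅D y, (φ m).1⁆ - _
    rw [hfst, add_sub_cancel_left]
    rfl

variable (s f)

/-- There is a representation of `L_i` with a nonzero vector on which the stabilizers of `f` in
`L_j`, `j ≥ i`, act through `f`. -/
theorem exists_representsOn (i : Fin (k + 1)) :
    ∃ (V : Type (max uK uL)) (_ : AddCommGroup V) (_ : Module K V) (ρ : L →ₗ[K] Module.End K V)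
      (v : V), v ≠ 0 ∧ RepresentsOn (s.ideal i) ρ ∧
      ∀ j, i ≤ j → ∀ x ∈ s.stabilizer f j, ρ x v = f x • v := by
  induction i using Fin.reverseInduction with
  | last =>
    refine ⟨ULift.{uL} K, inferInstance, inferInstance, 0, ⟨1⟩, ?_, ?_, ?_⟩
    · intro h
      exact one_ne_zero (congrArg ULift.down h)
    · intro x _ y _ v
      simp
    · intro j hj x hx
      have h := s.antitone hj hx.1
      rw [s.ideal_last, LieSubmodule.mem_bot] at h
      simp [h]
  | cast i ih =>
    obtain ⟨V, _, _, ρ, v, hv0, hρ, hv⟩ := ih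
    by_cases hi : s.ideal i.castSucc ≤ s.ideal i.succ
    · refine ⟨V, _, _, ρ, v, hv0, fun x hx y hy => hρ x (hi hx) y (hi hy), fun j hj x hx => ?_⟩
      rcases hj.eq_or_lt with rfl | hj
      · exact hv _ le_rfl x (s.mem_stabilizer_succ f i hx (hi hx.1))
      · exact hv j (Fin.castSucc_lt_iff_succ_le.1 hj) x hx
    have hext : ∀ {V' : Type (max uK uL)} [AddCommGroup V'] [Module K V']
        {ρ' : L →ₗ[K] Module.End K V'} {v' : V'} {x : L} {T : Module.End K V'}, v' ≠ 0 →
        RepresentsOn (s.ideal i.succ) ρ' →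
        (∀ j, i.succ ≤ j → ∀ x ∈ s.stabilizer f j, ρ' x v' = f x • v') →
        x ∈ s.ideal i.castSucc → x ∉ s.ideal i.succ →
        (∀ y ∈ s.ideal i.succ, ∀ v, ρ' ⁅x, y⁆ v = T (ρ' y v) - ρ' y (T v)) →
        (x ∈ s.stabilizer f i.castSucc ∧ T v' = f x • v' ∨
          s.stabilizer f i.castSucc ≤ (s.ideal i.succ).toSubmodule) →
        ∃ (V : Type (max uK uL)) (_ : AddCommGroup V) (_ : Module K V)
          (ρ : L →ₗ[K] Module.End K V) (v : V), v ≠ 0 ∧ RepresentsOn (s.ideal i.castSucc) ρ ∧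
          ∀ j, i.castSucc ≤ j → ∀ x ∈ s.stabilizer f j, ρ x v = f x • v := by
      intro V' _ _ ρ' v' x T hv0' hρ' hv' hx hx' hT hcase
      obtain ⟨l, hl, hl'⟩ := s.exists_dual_eq_one i hx'
      refine ⟨V', _, _, extendBy ρ' l x T, v', hv0',
        s.representsOn_extendBy i hx hx' hl hl' hρ' hT, fun j hj u hu => ?_⟩
      have hsucc : ∀ j, i.succ ≤ j → ∀ u ∈ s.stabilizer f j,
          extendBy ρ' l x T u v' = f u • v' := by
        intro j hj u hu
        rw [extendBy_apply, hl' u (s.antitone hj hu.1), zero_smul, zero_smul, sub_zero, add_zero,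
          hv' j hj u hu]
      rcases hj.eq_or_lt with rfl | hj
      · rcases hcase with ⟨hxs, hTv⟩ | hle
        · have hu1 : u - l u • x ∈ s.stabilizer f i.succ :=
            s.mem_stabilizer_succ f i (sub_mem hu (Submodule.smul_mem _ _ hxs))
              (s.sub_smul_mem_of_dual i hx hx' hl hl' hu.1)
          rw [extendBy_apply, hv' _ le_rfl _ hu1, hTv, smul_smul, ← add_smul]
          simp
        · exact hsucc _ le_rfl u (s.mem_stabilizer_succ f i hu (hle hu))
      · exact hsucc j (Fin.castSucc_lt_iff_succ_le.1 hj) u hu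
    by_cases hst : s.stabilizer f i.castSucc ≤ (s.ideal i.succ).toSubmodule
    -- L_i contributes no new stabilizer vectors, so x may act freely, as t on V[t].
    · obtain ⟨x, hx, hx'⟩ := SetLike.not_le_iff_exists.1 hi
      refine hext (V' := ℕ →₀ V) (ρ' := polyRep x ρ) (v' := Finsupp.single 0 v) (x := x)
        (T := shift V) ?_ (representsOn_polyRep x hρ) ?_ hx hx' ?_ (Or.inr hst)
      · rwa [Ne, Finsupp.single_eq_zero]
      · intro j hj y hy
        rw [polyRep_single_zero, hv j hj y hy, Finsupp.smul_single]
      · intro y _ w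
        rw [polyRep_shift]
        abel
    -- Here x must act on the vector as f(x), but V need not carry an action of x. The induced
    -- module of L_{i+1} does, through T; V only serves to show that its generator, which maps to v,
    -- is nonzero.
    · obtain ⟨x, hx, hx'⟩ := SetLike.not_le_iff_exists.1 hst
      obtain ⟨T, hTg, hT⟩ := exists_derivation i hx
      set N := (s.restrict (s.ideal i.succ)).M (res f (s.ideal i.succ))
      obtain ⟨φ, hφ, -⟩ := Ind.exists_lift (p := (s.restrict (s.ideal i.succ)).vergne _)
        (ρ := (s.restrict (s.ideal i.succ)).character (res f (s.ideal i.succ)))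
        (ρ.comp (s.ideal i.succ).toSubmodule.subtype)
        (fun x y v => hρ x x.2 y y.2 v) v (by
          rintro ⟨y, hy⟩
          let S : Submodule K L := LinearMap.eqLocus (LinearMap.flip ρ v) (f.smulRight v)
          have hyS : (y : L) ∈ S :=
            s.mem_of_mem_vergne_restrict f i.succ (fun j hj z hz => hv j hj z hz) hy
          refine Eq.trans (show _ = f y • v from hyS) ?_
          rw [character_apply]
          rfl)
      obtain ⟨ρ', hρ'⟩ := LinearMap.exists_extend (p := (s.ideal i.succ).toSubmodule)
        (LieModule.toEnd K (s.ideal i.succ) N : s.ideal i.succ →ₗ[K] Module.End K N)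
      have hρ'' : ∀ y (hy : y ∈ s.ideal i.succ) m,
          ρ' y m = ⁅(⟨y, hy⟩ : s.ideal i.succ), m⁆ := fun y hy m =>
        LinearMap.congr_fun (LinearMap.congr_fun hρ' ⟨y, hy⟩) m
      refine hext (V' := N) (ρ' := ρ') (v' := Ind.gen _ _) (x := x) (T := T) ?_ ?_ ?_ hx.1 hx' ?_
        (Or.inl ⟨hx, hTg⟩)
      · intro h
        rw [h, map_zero] at hφ
        exact hv0 hφ.symm
      · intro y hy z hz m
        rw [hρ'' _ (lie_mem_right K L _ y z hz), hρ'' z hz, hρ'' y hy, hρ'' z hz, hρ'' y hy,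
          ← lie_lie]
        rfl
      · intro j hj y hy
        rw [hρ'' y (s.antitone hj hy.1)]
        exact (s.restrict (s.ideal i.succ)).lie_gen_of_mem_vergne (res f (s.ideal i.succ))
          (s.mem_vergne_restrict_of_mem_stabilizer f hj hy)
      · intro y hy m
        rw [hρ'' _ (lie_mem_right K L _ x y hy), hρ'' y hy, hρ'' y hy]
        exact hT ⟨y, hy⟩ m

theorem gen_ne_zero : Ind.gen (s.vergne f) (s.character f) ≠ 0 := by
  obtain ⟨V, _, _, ρ, v, hv0, hρ, hv⟩ := s.exists_representsOn f 0
  rw [s.ideal_zero] at hρ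
  obtain ⟨φ, hφ, -⟩ := Ind.exists_lift (p := s.vergne f) (ρ := s.character f) ρ
    (fun x y w => hρ x trivial y trivial w) v (by
      rintro ⟨y, hy⟩
      have hle : (⨆ j, s.stabilizer f j) ≤
          LinearMap.eqLocus (LinearMap.flip ρ v) (f.smulRight v) :=
        iSup_le fun j z hz => hv j (Fin.zero_le j) z hz
      refine Eq.trans (show _ = f y • v from hle hy) ?_
      rw [character_apply])
  intro h
  rw [h, map_zero] at hφ
  exact hv0 hφ.symm

end Nonvanishing

end LieFiltration

end

/-! ### Irreducibility of M_s(f) -/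

noncomputable section

namespace LieFiltration

variable {K : Type*} [Field K] {L : Type*} [LieRing L] [LieAlgebra K L] {k : ℕ}
variable {V : Type*} [AddCommGroup V] [Module K V] [LieRingModule L V]

/-- The ideal `L_i` as a subalgebra. -/
abbrev subalgebra (s : LieFiltration K L k) (i : Fin (k + 1)) : LieSubalgebra K L :=
  LieIdeal.toLieSubalgebra K L (s.ideal i)

/-- Expresses irreducibility by subspaces of the ambient V, where generated submodules for different
i can be compared. -/
theorem isIrreducible_iff {I : LieIdeal K L} (N : LieSubmodule K I V) :
    LieModule.IsIrreducible K I N ↔ N.toSubmodule ≠ ⊥ ∧ ∀ N' ≤ N.toSubmodule,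
      (∀ x ∈ I, ∀ m ∈ N', ⁅x, m⁆ ∈ N') → N' ≠ ⊥ → N' = N.toSubmodule := by
  constructor
  · intro h
    have : Nontrivial N := LieModule.nontrivial_of_isIrreducible K I N
    constructor
    · exact (Submodule.nontrivial_iff_ne_bot (p := N.toSubmodule)).1 this
    · intro N' hle hinv hne
      let P : LieSubmodule K I N :=
        { toSubmodule := N'.comap N.toSubmodule.subtype
          lie_mem := fun {x m} hm => hinv x x.2 _ hm }
      obtain ⟨w, hw, hw0⟩ := N'.ne_bot_iff.1 hne
      have hP : P = ⊤ := (eq_bot_or_eq_top P).resolve_left fun hP => hw0 <| by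
        have hwP : (⟨w, hle hw⟩ : N) ∈ P := hw
        rw [hP, LieSubmodule.mem_bot] at hwP
        exact congrArg Subtype.val hwP
      refine le_antisymm hle fun m hm => ?_
      have hmP : (⟨m, hm⟩ : N) ∈ P := by rw [hP]; trivial
      exact hmP
  · rintro ⟨hne, h⟩
    have : Nontrivial N := (Submodule.nontrivial_iff_ne_bot (p := N.toSubmodule)).2 hne
    refine LieModule.IsIrreducible.mk fun P hP => ?_
    have hP' : P.toSubmodule.map N.toSubmodule.subtype = N.toSubmodule := by
      refine h _ (Submodule.map_subtype_le _ _) ?_ ?_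
      · rintro x hx _ ⟨m, hm, rfl⟩
        exact ⟨_, P.lie_mem (x := ⟨x, hx⟩) hm, rfl⟩
      · intro h0
        refine hP (eq_bot_iff.2 fun m hm => ?_)
        have hm' : (m : V) ∈ P.toSubmodule.map N.toSubmodule.subtype := ⟨m, hm, rfl⟩
        rw [h0, Submodule.mem_bot] at hm'
        exact (LieSubmodule.mem_bot m).2 (Subtype.ext hm')
    rw [eq_top_iff]
    rintro ⟨m, hm⟩ -
    obtain ⟨m', hm', h'⟩ := hP'.ge hm
    have : m' = ⟨m, hm⟩ := Subtype.ext h'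
    exact this ▸ hm'

variable [LieModule K L V]

theorem mem_weightSpace_subalgebra (s : LieFiltration K L k) (f : Module.Dual K L)
    {i : Fin (k + 1)} {m : V} : m ∈ weightSpace s f V (s.subalgebra i) ↔
      ∀ j, i ≤ j → ∀ x ∈ s.stabilizer f j, ⁅x, m⁆ = f x • m := by
  constructor
  · intro h j hij x hx
    exact h j x (s.antitone hij hx.1) hx.1 fun y _ hy => hx.2 y hy
  · intro h j x hxi hxj hx
    rcases le_total i j with hij | hij
    · exact h j hij x ⟨hxj, fun y hy => hx y (s.antitone hij hy) hy⟩
    · exact h i le_rfl x ⟨hxi, fun y hy => hx y hy (s.antitone hij hy)⟩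

/-- By `hull_inf_weightSpace` N meets the line K v, so it contains v and everything v generates. -/
theorem eq_hull_span_singleton [CharZero K] (s : LieFiltration K L k) {f : Module.Dual K L}
    {H : LieSubalgebra K L} {v : V} (hv : v ∈ weightSpace s f V H) {N : Submodule K V}
    (hN : N ≤ hull H (K ∙ v)) (hinv : ∀ x ∈ H, ∀ m ∈ N, ⁅x, m⁆ ∈ N) (hne : N ≠ ⊥) :
    N = hull H (K ∙ v) := by
  have hE : (K ∙ v) ≤ weightSpace s f V H := (Submodule.span_singleton_le_iff_mem _ _).2 hv
  obtain ⟨w, ⟨hwN, hwv⟩, hw0⟩ :=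
    (Submodule.ne_bot_iff _).1 ((s.hull_inf_weightSpace f H hE).2 N hN hinv hne)
  obtain ⟨c, rfl⟩ := Submodule.mem_span_singleton.1 hwv
  have hc : c ≠ 0 := by
    rintro rfl
    exact hw0 (zero_smul K v)
  refine le_antisymm hN (hull_le ?_ hinv)
  rw [Submodule.span_singleton_le_iff_mem]
  exact (N.smul_mem_iff hc).1 hwN

section Ms

variable (s : LieFiltration K L k) (f : Module.Dual K L)

/-- The generator `1 ⊗ 1` of `M(f)`. -/
abbrev gen : s.M f := Ind.gen (s.vergne f) (s.character f)

theorem gen_mem_weightSpace (i : Fin (k + 1)) :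
    s.gen f ∈ weightSpace s f (s.M f) (s.subalgebra i) :=
  (s.mem_weightSpace_subalgebra f).2 fun j _ _ hx =>
    s.lie_gen_of_mem_vergne f (Submodule.mem_iSup_of_mem (p := s.stabilizer f) j hx)

/-- All steps of the filtration have the common generator 1 ⊗ 1, so the results on generated
submodules apply to each L_i inside M(f). -/
theorem Ms_sub_eq_hull (i : Fin (k + 1)) :
    ((s.Ms f).sub i).toSubmodule = hull (s.subalgebra i) (K ∙ s.gen f) := by
  apply le_antisymm
  · intro m hm
    obtain ⟨u, rfl⟩ := (s.mem_range_stepMap f i m).1 hm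
    rw [← Ind.smul_gen]
    exact Ind.envMap_smul_mem _ (fun x m hm => lie_mem_hull _ _ x.2 hm) u
      (le_hull _ _ (Submodule.mem_span_singleton_self _))
  · refine hull_le ?_ fun x hx m hm => ((s.Ms f).sub i).lie_mem (x := ⟨x, hx⟩) hm
    rw [Submodule.span_singleton_le_iff_mem]
    exact (s.mem_range_stepMap f i _).2 ⟨1, by rw [map_one]; rfl⟩

theorem isIrreducible_Ms [CharZero K] : (s.Ms f).IsIrreducible := by
  intro i
  rw [isIrreducible_iff, Ms_sub_eq_hull]
  refine ⟨fun h => s.gen_ne_zero f ?_, fun N hN hinv hne =>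
    s.eq_hull_span_singleton (s.gen_mem_weightSpace f i) hN hinv hne⟩
  rw [← Submodule.mem_bot K, ← h]
  exact le_hull _ _ (Submodule.mem_span_singleton_self _)

end Ms

/-! ### Every irreducible module is some M_s(f) -/

section Classification

variable {s : LieFiltration K L k}

theorem hull_eq_sub {F : s.FilteredModule V} (hF : F.IsIrreducible) {i : Fin (k + 1)}
    {N : Submodule K V} (hN : N ≤ (F.sub i).toSubmodule) (hne : N ≠ ⊥) :
    hull (s.subalgebra i) N = (F.sub i).toSubmodule := by
  refine ((isIrreducible_iff _).1 (hF i)).2 _ (hull_le hN fun x hx m hm =>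
    (F.sub i).lie_mem (x := ⟨x, hx⟩) hm) (fun x hx m hm => lie_mem_hull _ _ hx hm) ?_
  exact fun h => hne (eq_bot_iff.2 (h ▸ le_hull _ _))

/-- A linear operator without proper nonzero invariant subspaces acts by a scalar, if the field is
algebraically closed. -/
theorem exists_eigenvalue_of_simple [IsAlgClosed K] {T : Module.End K V} {W : Submodule K V}
    (hT : ∀ m ∈ W, T m ∈ W)
    (hW : ∀ E ≤ W, (∀ m ∈ E, T m ∈ E) → E ≠ ⊥ → W ≤ E) {v : V} (hv : v ∈ W) (hv0 : v ≠ 0) :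
    ∃ c : K, T v = c • v := by
  have hpoly : ∀ p : Polynomial K, Polynomial.aeval T p v ∈ W := by
    intro p
    induction p using Polynomial.induction_on' with
    | add p q hp hq => rw [map_add, LinearMap.add_apply]; exact add_mem hp hq
    | monomial n a =>
      rw [Polynomial.aeval_monomial, Module.End.mul_apply, Module.algebraMap_end_apply]
      refine W.smul_mem a ?_
      induction n with
      | zero => exact hv
      | succ n ih => rw [pow_succ', Module.End.mul_apply]; exact hT _ ih
  by_cases hTv : T v = 0
  · exact ⟨0, by rw [hTv, zero_smul]⟩
  -- E is spanned by T v, T² v, ...; it is invariant and nonzero, so it contains v, and v = T p(T) v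
  -- makes v a root vector of X p - 1.
  let E : Submodule K V := LinearMap.range
    ((LinearMap.applyₗ v).comp ((Polynomial.aeval T).toLinearMap.comp
      (LinearMap.mulLeft K (Polynomial.X : Polynomial K))))
  have hE : ∀ p : Polynomial K, Polynomial.aeval T (Polynomial.X * p) v ∈ E := fun p => ⟨p, rfl⟩
  have hvE : v ∈ E := by
    refine hW E ?_ ?_ ?_ hv
    · rintro _ ⟨p, rfl⟩
      exact hpoly _
    · rintro _ ⟨p, rfl⟩
      refine ⟨Polynomial.X * p, ?_⟩
      simp
    · refine (Submodule.ne_bot_iff _).2 ⟨T v, ?_, hTv⟩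
      simpa using hE 1
  obtain ⟨p, hp⟩ := hvE
  have hp' : Polynomial.aeval T (Polynomial.X * p - 1) v = 0 := by
    rw [map_sub, LinearMap.sub_apply, map_one, Module.End.one_apply]
    exact sub_eq_zero.2 hp
  have hne : (Polynomial.X * p - 1 : Polynomial K) ≠ 0 := by
    intro h
    have := congrArg (Polynomial.eval 0) h
    simp at this
  -- Split off a root c of r: either w is an eigenvector, or T w - c w is nonzero and killed by the
  -- cofactor.
  have hroot : ∀ n, ∀ r : Polynomial K, r.natDegree = n → r ≠ 0 → ∀ w ∈ W, w ≠ 0 →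
      Polynomial.aeval T r w = 0 → ∃ c : K, ∃ w ∈ W, w ≠ 0 ∧ T w = c • w := by
    intro n
    induction n with
    | zero =>
      intro r hr hr0 w _ hw0 h
      rw [Polynomial.eq_C_of_natDegree_eq_zero hr, Polynomial.aeval_C,
        Module.algebraMap_end_apply] at h
      have hc : r.coeff 0 ≠ 0 := fun hc => hr0 (by
        rw [Polynomial.eq_C_of_natDegree_eq_zero hr, hc, Polynomial.C_0])
      exact absurd h (smul_ne_zero hc hw0)
    | succ n ih =>
      intro r hr hr0 w hw hw0 h
      obtain ⟨c, hc⟩ := IsAlgClosed.exists_root r (by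
        rw [Polynomial.degree_eq_natDegree hr0, hr]
        exact_mod_cast n.succ_ne_zero)
      obtain ⟨r', rfl⟩ := Polynomial.dvd_iff_isRoot.2 hc
      have hr0' : r' ≠ 0 := right_ne_zero_of_mul hr0
      have hdeg : r'.natDegree = n := by
        rw [Polynomial.natDegree_mul (Polynomial.X_sub_C_ne_zero c) hr0',
          Polynomial.natDegree_X_sub_C] at hr
        omega
      by_cases hw' : T w = c • w
      · exact ⟨c, w, hw, hw0, hw'⟩
      · refine ih r' hdeg hr0' (T w - c • w) (sub_mem (hT w hw) (W.smul_mem c hw))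
          (sub_ne_zero.2 hw') ?_
        rw [mul_comm, map_mul, Module.End.mul_apply] at h
        simpa using h
  obtain ⟨c, w, hw, hw0, hTw⟩ := hroot _ _ rfl hne v hv hv0 hp'
  refine ⟨c, ?_⟩
  -- The c-eigenvectors in W form a nonzero invariant subspace, hence all of W.
  let E' : Submodule K V := W ⊓ LinearMap.ker (T - c • LinearMap.id)
  have hE' : ∀ m, m ∈ E' ↔ m ∈ W ∧ T m = c • m := fun m => by
    simp [E', sub_eq_zero]
  have hWE' : W ≤ E' := hW E' inf_le_left (fun m hm => by
    rw [hE'] at hm ⊢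
    rw [hm.2]
    exact ⟨W.smul_mem c hm.1, by rw [map_smul, hm.2]⟩)
    ((Submodule.ne_bot_iff _).2 ⟨w, (hE' w).2 ⟨hw, hTw⟩, hw0⟩)
  exact ((hE' v).1 (hWE' hv)).2

/-- Changing `f` on `L_i` outside `L_{i+1}` does not change the stabilizers in `L_j`, `j ≥ i`. -/
theorem mem_stabilizer_congr {f f' : Module.Dual K L} {i : Fin k}
    (h : ∀ y ∈ s.ideal i.succ, f y = f' y) {j : Fin (k + 1)} (hj : i.castSucc ≤ j) {x : L}
    (hx : x ∈ s.stabilizer f j) : x ∈ s.stabilizer f' j :=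
  ⟨hx.1, fun y hy => by
    rw [← h _ (s.lie_mem_ideal_succ i (s.antitone hj hx.1) (s.antitone hj hy)), hx.2 y hy]⟩

variable [CharZero K] [IsAlgClosed K]

/-- Let W be the space of L_{i+1}-weight vectors in V_i. Bracketing with x maps each stabilizer of
index j > i into itself and into the kernel of f, so x preserves W. If E ⊆ W is nonzero and
x-stable, the L_{i+1}-module it generates is stable under x, hence under L_i, and equals V_i; then
`hull_inf_weightSpace` gives W ⊆ E. So `exists_eigenvalue_of_simple` applies to x on W. -/
theorem exists_eigenvalue_of_mem_stabilizer {F : s.FilteredModule V} (hF : F.IsIrreducible)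
    {f : Module.Dual K L} {i : Fin k} {x : L} (hx : x ∈ s.stabilizer f i.castSucc)
    (hx' : x ∉ s.ideal i.succ) {v : V} (hv : v ∈ (F.sub i.castSucc).toSubmodule) (hv0 : v ≠ 0)
    (hvf : v ∈ weightSpace s f V (s.subalgebra i.succ)) : ∃ c : K, ⁅x, v⁆ = c • v := by
  refine exists_eigenvalue_of_simple (T := LieModule.toEnd K L V x)
    (W := (F.sub i.castSucc).toSubmodule ⊓ weightSpace s f V (s.subalgebra i.succ))
    ?_ ?_ ⟨hv, hvf⟩ hv0
  · rintro m ⟨hm, hmf⟩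
    refine ⟨(F.sub i.castSucc).lie_mem (x := ⟨x, hx.1⟩) hm, ?_⟩
    rw [SetLike.mem_coe, mem_weightSpace_subalgebra] at hmf ⊢
    intro j hj y hy
    have hij := i.castSucc_lt_succ.le.trans hj
    have h := hmf j hj _ (s.lie_mem_stabilizer f hij hx hy)
    rw [hx.2 y (s.antitone hij hy.1), zero_smul, lie_lie, hmf j hj y hy, lie_smul,
      sub_eq_zero] at h
    exact h.symm
  · intro E hE hxE hne
    have hEf : E ≤ weightSpace s f V (s.subalgebra i.succ) := hE.trans inf_le_right
    have hxh : ∀ m ∈ hull (s.subalgebra i.succ) E, ⁅x, m⁆ ∈ hull (s.subalgebra i.succ) E := by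
      have hle : hull (s.subalgebra i.succ) E ≤ hull (s.subalgebra i.succ) E ⊓
          (hull (s.subalgebra i.succ) E).comap (LieModule.toEnd K L V x) := by
        refine hull_le (fun m hm => ⟨le_hull _ _ hm, le_hull _ _ (hxE m hm)⟩) ?_
        rintro y hy m ⟨hm, hm'⟩
        refine ⟨lie_mem_hull _ _ hy hm, ?_⟩
        change ⁅x, ⁅y, m⁆⁆ ∈ hull (s.subalgebra i.succ) E
        rw [leibniz_lie]
        exact add_mem (lie_mem_hull _ _ (lie_mem_right K L _ x y hy) hm) (lie_mem_hull _ _ hy hm')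
      exact fun m hm => (hle hm).2
    have hle : hull (s.subalgebra i.castSucc) E ≤ hull (s.subalgebra i.succ) E := by
      refine hull_le (le_hull _ _) fun u hu m hm => ?_
      obtain ⟨c, hc⟩ := s.exists_sub_smul_mem i hx.1 hx' hu
      have e : ⁅u, m⁆ = ⁅u - c • x, m⁆ + c • ⁅x, m⁆ := by rw [sub_lie, smul_lie, sub_add_cancel]
      rw [e]
      exact add_mem (lie_mem_hull _ _ hc hm) (Submodule.smul_mem _ c (hxh m hm))
    rw [hull_eq_sub hF (hE.trans inf_le_left) hne] at hle
    exact (inf_le_inf_right _ hle).trans (s.hull_inf_weightSpace f _ hEf).1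

/-- Induction up the chain. When x is a new stabilizer vector with eigenvalue c on v, f is changed
by a form vanishing on L_{i+1} so that f(x) becomes c; the stabilizers do not change, since [L_i,
L_i] ⊆ L_{i+1}. -/
theorem exists_mem_weightSpace {F : s.FilteredModule V} (hF : F.IsIrreducible) {v : V}
    (hv : v ∈ (F.sub (Fin.last k)).toSubmodule) (hv0 : v ≠ 0) (i : Fin (k + 1)) :
    ∃ f : Module.Dual K L, v ∈ weightSpace s f V (s.subalgebra i) := by
  induction i using Fin.reverseInduction with
  | last =>
    refine ⟨0, (s.mem_weightSpace_subalgebra 0).2 fun j hj x hx => ?_⟩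
    have h := s.antitone hj hx.1
    rw [s.ideal_last, LieSubmodule.mem_bot] at h
    simp [h]
  | cast i ih =>
    obtain ⟨f, hf⟩ := ih
    have hf' := (s.mem_weightSpace_subalgebra f).1 hf
    by_cases hst : s.stabilizer f i.castSucc ≤ (s.ideal i.succ).toSubmodule
    · refine ⟨f, (s.mem_weightSpace_subalgebra f).2 fun j hj x hx => ?_⟩
      rcases hj.eq_or_lt with rfl | hj
      · exact hf' _ le_rfl x (s.mem_stabilizer_succ f i hx (hst hx))
      · exact hf' j (Fin.castSucc_lt_iff_succ_le.1 hj) x hx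
    obtain ⟨x, hx, hx'⟩ := SetLike.not_le_iff_exists.1 hst
    obtain ⟨c, hc⟩ := exists_eigenvalue_of_mem_stabilizer hF hx hx'
      (F.antitone (Fin.le_last _) hv) hv0 hf
    obtain ⟨l, hl, hl'⟩ := s.exists_dual_eq_one i hx'
    let f' : Module.Dual K L := f + (c - f x) • l
    have hff' : ∀ y ∈ s.ideal i.succ, f' y = f y := fun y hy => by simp [f', hl' y hy]
    have hf'x : f' x = c := by simp [f', hl]
    have hsucc : ∀ j, i.succ ≤ j → ∀ y ∈ s.stabilizer f' j, ⁅y, v⁆ = f' y • v := by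
      intro j hj y hy
      rw [hff' y (s.antitone hj hy.1)]
      exact hf' j hj y (mem_stabilizer_congr hff' (i.castSucc_lt_succ.le.trans hj) hy)
    refine ⟨f', (s.mem_weightSpace_subalgebra f').2 fun j hj y hy => ?_⟩
    rcases hj.eq_or_lt with rfl | hj
    · have hxf' : x ∈ s.stabilizer f' i.castSucc :=
        mem_stabilizer_congr (fun y hy => (hff' y hy).symm) le_rfl hx
      have h := hsucc _ le_rfl _ (s.mem_stabilizer_succ f' i
        (sub_mem hy (Submodule.smul_mem _ (l y) hxf'))
        (s.sub_smul_mem_of_dual i hx.1 hx' hl hl' hy.1))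
      rw [sub_lie, smul_lie, hc, map_sub, map_smul, hf'x, sub_smul, smul_smul, smul_eq_mul] at h
      exact sub_left_injective h
    · exact hsucc j (Fin.castSucc_lt_iff_succ_le.1 hj) y hy

/-- The map 1 ⊗ 1 ↦ v sends the L_i-module generated by 1 ⊗ 1 onto the one generated by v, which is
V_i. By `eq_hull_span_singleton` a nonzero kernel would contain 1 ⊗ 1, against v ≠ 0. -/
theorem exists_equivalent_Ms {F : s.FilteredModule V} (hF : F.IsIrreducible) :
    ∃ f : Module.Dual K L, F.Equivalent (s.Ms f) := by
  obtain ⟨v, hv, hv0⟩ := (Submodule.ne_bot_iff _).1 ((isIrreducible_iff _).1 (hF (Fin.last k))).1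
  obtain ⟨f, hf⟩ := exists_mem_weightSpace hF hv hv0 0
  have hf' := (s.mem_weightSpace_subalgebra f).1 hf
  refine ⟨f, ?_⟩
  obtain ⟨φ, hφg, hφ⟩ := Ind.exists_lift (p := s.vergne f) (ρ := s.character f)
    (LieModule.toEnd K L V : L →ₗ[K] Module.End K V) (fun x y w => lie_lie x y w) v (by
      rintro ⟨y, hy⟩
      have hle : (⨆ j, s.stabilizer f j) ≤ LinearMap.eqLocus
          (LinearMap.flip (LieModule.toEnd K L V : L →ₗ[K] Module.End K V) v) (f.smulRight v) :=
        iSup_le fun j z hz => hf' j (Fin.zero_le j) z hz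
      rw [character_apply]
      exact hle hy)
  replace hφ : ∀ x m, φ ⁅x, m⁆ = ⁅x, φ m⁆ := hφ
  have hsub : ∀ i, ((s.Ms f).sub i).toSubmodule.map φ = (F.sub i).toSubmodule := by
    intro i
    have hvi : v ∈ (F.sub i).toSubmodule := F.antitone (Fin.le_last i) hv
    rw [Ms_sub_eq_hull, ← hull_eq_sub hF ((Submodule.span_singleton_le_iff_mem _ _).2 hvi)
      (by rwa [Ne, Submodule.span_singleton_eq_bot])]
    apply le_antisymm
    · rw [Submodule.map_le_iff_le_comap]
      refine hull_le ?_ fun x hx m hm => ?_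
      · rw [Submodule.span_singleton_le_iff_mem, Submodule.mem_comap, hφg]
        exact le_hull _ _ (Submodule.mem_span_singleton_self v)
      · rw [Submodule.mem_comap, hφ]
        exact lie_mem_hull _ _ hx hm
    · refine hull_le ?_ ?_
      · rw [Submodule.span_singleton_le_iff_mem]
        exact ⟨_, le_hull _ _ (Submodule.mem_span_singleton_self _), hφg⟩
      · rintro x hx _ ⟨m, hm, rfl⟩
        exact ⟨⁅x, m⁆, lie_mem_hull _ _ hx hm, hφ x m⟩
  have hsurj : Function.Surjective φ := by
    have h := hsub 0
    rw [(s.Ms f).sub_zero, F.sub_zero, Submodule.map_top] at h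
    exact LinearMap.range_eq_top.1 h
  have hinj : Function.Injective φ := by
    rw [← LinearMap.ker_eq_bot]
    by_contra hne
    have htop : hull (s.subalgebra 0) (K ∙ s.gen f) = ⊤ := by
      rw [← Ms_sub_eq_hull, (s.Ms f).sub_zero]
    have h := s.eq_hull_span_singleton (s.gen_mem_weightSpace f 0) (N := LinearMap.ker φ)
      (by rw [htop]; exact le_top)
      (fun x _ m hm => by
        rw [LinearMap.mem_ker] at hm ⊢
        rw [hφ, hm, lie_zero]) hne
    have hg : s.gen f ∈ LinearMap.ker φ := by rw [h, htop]; trivial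
    rw [LinearMap.mem_ker, hφg] at hg
    exact hv0 hg
  let C : s.M f ≃ₗ⁅K, L⁆ V :=
    { LinearEquiv.ofBijective φ ⟨hinj, hsurj⟩ with
      map_lie' := fun {x m} => hφ x m }
  refine ⟨C.symm, fun i => ?_⟩
  rw [← hsub i, ← Submodule.map_comp]
  have hC : (C.symm : V →ₗ[K] s.M f).comp φ = LinearMap.id :=
    LinearMap.ext fun m => C.symm_apply_apply m
  exact (congrArg (fun g => Submodule.map g _) hC).trans (Submodule.map_id _)

end Classification

end LieFiltration

end

theorem theorem2p4 {K : Type*} [Field K] [CharZero K] [IsAlgClosed K]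
    {L : Type*} [LieRing L] [LieAlgebra K L] [LieAlgebra.IsSolvable L]
    {k : ℕ} (s : LieFiltration K L k) :
    (∀ f : Module.Dual K L, (s.Ms f).IsIrreducible) ∧
    (∀ {V : Type*} [AddCommGroup V] [Module K V] [LieRingModule L V] [LieModule K L V]
      (F : s.FilteredModule V), F.IsIrreducible →
        ∃ f : Module.Dual K L, F.Equivalent (s.Ms f)) :=
  ⟨fun f => s.isIrreducible_Ms f, fun _ hF => LieFiltration.exists_equivalent_Ms hF⟩
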